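/- Let $d>0$ be a real number. For $u_0>0$ consider the initial value problem $$u''+\frac{d-1}{r}\,u'=(V-1)\,u,\qquad V''+\frac{d-1}{r}\,V'=u^2\qquad (r>0),$$ $$u(0)=u_0,\quad u'(0)=0,\quad V(0)=0,\quad V'(0)=0,$$ where solutions are understood to be real-valued functions $u,V\in C^2([0,\infty))$ (with one-sided derivatives at $0$). Then there is exactly one $u_0>0$ for which this problem has a solution $(u,V)$ satisfying $$u(r)>0,\quad u'(r)<0\ \text{ for all } r\in(0,\infty),\qquad \lim_{r\to\infty}u(r)=0,$$ and this solution $(u,V)$ is unique. If $d=6$, it is given by $$u(r)=\Bigl(1+\frac{r^2}{24}\Bigr)^{-2}\qquad (r\ge 0).$$ Moreover, for every $d\ge 6$ the relation $u(r)=1-V(r)$ holds for all $r\ge 0$, and $u$ solves the Lane--Emden equation $$u''+\frac{d-1}{r}\,u'=-u^2\qquad (r>0),\qquad u(0)=1,\quad u'(0)=0.$$ -/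

import Mathlib

/-- The radial Laplacian in (real) dimension `d`: `f'' + ((d - 1) / r) f'` at a point `r > 0`. -/
noncomputable def radialLaplacian (d : ℝ) (f : ℝ → ℝ) (r : ℝ) : ℝ :=
  deriv (deriv f) r + (d - 1) / r * deriv f r

/-- `(u, V)` is a classical solution on `[0, ∞)` of the radial Schrödinger-Newton system with
initial data `u 0 = u₀`, `u' 0 = 0`, `V 0 = 0`, `V' 0 = 0`. Both functions are twice continuously
differentiable on `[0, ∞)`, with one-sided derivatives at `0`; their values at negative arguments
are irrelevant. -/
structure IsSchrodingerNewtonSolution (d u₀ : ℝ) (u V : ℝ → ℝ) : Prop where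
  contDiffOn_u : ContDiffOn ℝ 2 u (Set.Ici 0)
  contDiffOn_V : ContDiffOn ℝ 2 V (Set.Ici 0)
  eq_u : ∀ r : ℝ, 0 < r → radialLaplacian d u r = (V r - 1) * u r
  eq_V : ∀ r : ℝ, 0 < r → radialLaplacian d V r = u r ^ 2
  u_zero : u 0 = u₀
  deriv_u_zero : derivWithin u (Set.Ici 0) 0 = 0
  V_zero : V 0 = 0
  deriv_V_zero : derivWithin V (Set.Ici 0) 0 = 0

/-- `(u, V)` is a ground state with initial value `u₀ > 0`: a solution of the initial value problem
with `u > 0` and `u' < 0` on `(0, ∞)` and `u → 0` at infinity. -/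
structure IsGroundState (d u₀ : ℝ) (u V : ℝ → ℝ) : Prop
    extends IsSchrodingerNewtonSolution d u₀ u V where
  init_pos : 0 < u₀
  pos : ∀ r : ℝ, 0 < r → 0 < u r
  deriv_neg : ∀ r : ℝ, 0 < r → deriv u r < 0
  tendsto_zero : Filter.Tendsto u Filter.atTop (nhds 0)

/-- `u` is a classical solution on `[0, ∞)` of the quadratic Lane-Emden equation in dimension `d`
with initial data `u 0 = 1`, `u' 0 = 0`. -/
structure IsLaneEmdenSolution (d : ℝ) (u : ℝ → ℝ) : Prop where
  contDiffOn : ContDiffOn ℝ 2 u (Set.Ici 0)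
  eq : ∀ r : ℝ, 0 < r → radialLaplacian d u r = -(u r) ^ 2
  zero : u 0 = 1
  deriv_zero : derivWithin u (Set.Ici 0) 0 = 0

/-! Everything rests on the divergence form (r^(d-1) u')' = r^(d-1) Δu: since the flux vanishes at
the origin, the sign of Δu controls the monotonicity of u, which gives comparison principles for
every real d > 0.

Uniqueness. The function ψ = 1 - V - u satisfies Δψ = uψ, so its initial sign persists. A ground
state with u(0) < 1 would satisfy Δu ≤ -k u with k > 0, which no positive function can
(`IsRadial.not_pos_of_laplacian_le`); hence u(0) ≥ 1. For ground states u, w with u(0) < w(0), the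
ratio w/u is nondecreasing, so w > u and W > V throughout, and the weighted Wronskian r^(d-1)(w'u -
wu') is positive and nondecreasing. As w(0) > 1, eventually W - 1 is bounded below, and this makes
r^(d-1) w bounded. Then -u' is bounded below by a positive constant and u turns negative
(`IsGroundState.not_init_lt`). Equal initial values give equal solutions by a Gronwall-type
estimate.

Existence. Truncating the nonlinearity gives global solutions that depend continuously on a = u(0).
The values a for which u becomes negative, and those for which u increases somewhere while still
positive, form disjoint open sets. Each meets the interval [1/2, K], so connectedness leaves some a
in neither, and its solution is a ground state (`exists_isGroundState`).

Dimension d ≥ 6. Pohozaev's identity keeps the Lane–Emden solution u positive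
(`IsRadial.pos_of_pohozaev`). Then (u, 1 - u) is a ground state, and by uniqueness the only one. -/

open Set Filter Topology
open scoped BoundedContinuousFunction

/-! ### Calculus of radial functions -/

/-- `u` is a radial function in dimension `d`, with derivative `u'` and Laplacian `g`, regular at
the origin in the sense that the flux `r ^ (d - 1) * u' r` vanishes there. -/
structure IsRadial (d : ℝ) (u u' g : ℝ → ℝ) : Prop where
  continuousOn : ContinuousOn u (Ici 0)
  hasDerivAt : ∀ r, 0 < r → HasDerivAt u (u' r) r
  hasDerivAt' : ∀ r, 0 < r → HasDerivAt u' (g r - (d - 1) / r * u' r) r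
  flux_tendsto : Tendsto (fun s => s ^ (d - 1) * u' s) (𝓝[>] 0) (𝓝 0)

namespace IsRadial

variable {d : ℝ} {u u' g v v' h : ℝ → ℝ}

theorem flux_hasDerivAt (hu : IsRadial d u u' g) {r : ℝ} (hr : 0 < r) :
    HasDerivAt (fun s => s ^ (d - 1) * u' s) (r ^ (d - 1) * g r) r := by
  have h1 := (Real.hasDerivAt_rpow_const (p := d - 1) (Or.inl hr.ne')).mul (hu.hasDerivAt' r hr)
  refine h1.congr_deriv ?_
  rw [Real.rpow_sub_one hr.ne' (d - 1)]
  field_simp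
  ring

theorem add (hu : IsRadial d u u' g) (hv : IsRadial d v v' h) :
    IsRadial d (fun r => u r + v r) (fun r => u' r + v' r) (fun r => g r + h r) where
  continuousOn := hu.continuousOn.add hv.continuousOn
  hasDerivAt r hr := (hu.hasDerivAt r hr).add (hv.hasDerivAt r hr)
  hasDerivAt' r hr := ((hu.hasDerivAt' r hr).add (hv.hasDerivAt' r hr)).congr_deriv (by ring)
  flux_tendsto := by simpa [mul_add] using hu.flux_tendsto.add hv.flux_tendsto

theorem const_mul (hu : IsRadial d u u' g) (c : ℝ) :
    IsRadial d (fun r => c * u r) (fun r => c * u' r) (fun r => c * g r) where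
  continuousOn := hu.continuousOn.const_mul c
  hasDerivAt r hr := (hu.hasDerivAt r hr).const_mul c
  hasDerivAt' r hr := ((hu.hasDerivAt' r hr).const_mul c).congr_deriv (by ring)
  flux_tendsto := by
    simpa [mul_left_comm] using hu.flux_tendsto.const_mul c

theorem congr_laplacian (hu : IsRadial d u u' g) (hg : ∀ r, 0 < r → g r = h r) :
    IsRadial d u u' h :=
  ⟨hu.continuousOn, hu.hasDerivAt, fun r hr => hg r hr ▸ hu.hasDerivAt' r hr, hu.flux_tendsto⟩

theorem sub (hu : IsRadial d u u' g) (hv : IsRadial d v v' h) :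
    IsRadial d (fun r => u r - v r) (fun r => u' r - v' r) (fun r => g r - h r) := by
  simpa [sub_eq_add_neg] using hu.add (hv.const_mul (-1))

theorem const (d c : ℝ) : IsRadial d (fun _ => c) (fun _ => 0) (fun _ => 0) where
  continuousOn := continuousOn_const
  hasDerivAt r _ := hasDerivAt_const r c
  hasDerivAt' r _ := by simpa using hasDerivAt_const r (0 : ℝ)
  flux_tendsto := by simp

/-- Barrier for constant bounds on the Laplacian. -/
theorem sq (hd : 0 < d) : IsRadial d (fun r => r ^ 2 / (2 * d)) (fun r => r / d) (fun _ => 1) where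
  continuousOn := by fun_prop
  hasDerivAt r _ := ((hasDerivAt_pow 2 r).div_const (2 * d)).congr_deriv (by field_simp; norm_num)
  hasDerivAt' r hr := ((hasDerivAt_id r).div_const d).congr_deriv (by field_simp; ring)
  flux_tendsto := by
    have h1 : Tendsto (fun s : ℝ => s ^ d / d) (𝓝[>] 0) (𝓝 0) := by
      have := (Real.continuousAt_rpow_const 0 d (Or.inr hd.le)).tendsto.mono_left
        (nhdsWithin_le_nhds (s := Ioi 0))
      simpa [Real.zero_rpow hd.ne'] using this.div_const d
    refine h1.congr' ?_
    filter_upwards [self_mem_nhdsWithin] with s (hs : 0 < s)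
    rw [Real.rpow_sub_one hs.ne']
    field_simp

/-- Barrier for Laplacians that grow quadratically, as (V - 1)u does when u stays bounded below. -/
theorem pow_four (hd : 0 < d) :
    IsRadial d (fun r => r ^ 4 / (4 * (d + 2))) (fun r => r ^ 3 / (d + 2)) (fun r => r ^ 2) where
  continuousOn := by fun_prop
  hasDerivAt r _ := ((hasDerivAt_pow 4 r).div_const (4 * (d + 2))).congr_deriv
    (by field_simp; norm_num)
  hasDerivAt' r hr := ((hasDerivAt_pow 3 r).div_const (d + 2)).congr_deriv
    (by field_simp; norm_num; ring)
  flux_tendsto := by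
    have h1 : Tendsto (fun s : ℝ => s ^ d * s ^ 2 / (d + 2)) (𝓝[>] 0) (𝓝 0) := by
      have h0 : ContinuousAt (fun s : ℝ => s ^ d * s ^ 2 / (d + 2)) 0 :=
        ((Real.continuousAt_rpow_const 0 d (Or.inr hd.le)).mul
          (continuousAt_id.pow 2)).div_const _
      simpa using h0.tendsto.mono_left (nhdsWithin_le_nhds (s := Ioi 0))
    refine h1.congr' ?_
    filter_upwards [self_mem_nhdsWithin] with s (hs : 0 < s)
    rw [Real.rpow_sub_one hs.ne']
    field_simp

theorem flux_continuousOn (hu : IsRadial d u u' g) :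
    ContinuousOn (fun s => s ^ (d - 1) * u' s) (Ioi 0) :=
  fun _ hr => (hu.flux_hasDerivAt hr).continuousAt.continuousWithinAt

theorem flux_monotoneOn (hu : IsRadial d u u' g) {a R : ℝ} (ha : 0 ≤ a)
    (hg : ∀ r ∈ Ioo a R, 0 ≤ g r) :
    MonotoneOn (fun s => s ^ (d - 1) * u' s) (Ioc a R) := by
  refine monotoneOn_of_hasDerivWithinAt_nonneg (convex_Ioc a R)
    (hu.flux_continuousOn.mono fun x hx => ha.trans_lt hx.1)
    (f' := fun r => r ^ (d - 1) * g r) ?_ ?_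
  · intro x hx
    rw [interior_Ioc] at hx
    exact (hu.flux_hasDerivAt (ha.trans_lt hx.1)).hasDerivWithinAt
  · intro x hx
    rw [interior_Ioc] at hx
    have := hg x hx
    have := ha.trans_lt hx.1
    positivity

theorem flux_monotoneOn_Icc (hu : IsRadial d u u' g) {a R : ℝ} (ha : 0 < a)
    (hg : ∀ r ∈ Ioo a R, 0 ≤ g r) :
    MonotoneOn (fun s => s ^ (d - 1) * u' s) (Icc a R) := by
  refine monotoneOn_of_hasDerivWithinAt_nonneg (convex_Icc a R)
    (hu.flux_continuousOn.mono fun x hx => ha.trans_le hx.1)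
    (f' := fun r => r ^ (d - 1) * g r) ?_ ?_
  · intro x hx
    rw [interior_Icc] at hx
    exact (hu.flux_hasDerivAt (ha.trans hx.1)).hasDerivWithinAt
  · intro x hx
    rw [interior_Icc] at hx
    have := hg x hx
    have := ha.trans hx.1
    positivity

theorem flux_strictMonoOn (hu : IsRadial d u u' g) {a R : ℝ} (ha : 0 < a)
    (hg : ∀ r ∈ Ioo a R, 0 < g r) :
    StrictMonoOn (fun s => s ^ (d - 1) * u' s) (Icc a R) := by
  refine strictMonoOn_of_hasDerivWithinAt_pos (convex_Icc a R)
    (hu.flux_continuousOn.mono fun x hx => ha.trans_le hx.1)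
    (f' := fun r => r ^ (d - 1) * g r) ?_ ?_
  · intro x hx
    rw [interior_Icc] at hx
    exact (hu.flux_hasDerivAt (ha.trans hx.1)).hasDerivWithinAt
  · intro x hx
    rw [interior_Icc] at hx
    have := hg x hx
    have := ha.trans hx.1
    positivity

theorem deriv_nonneg (hu : IsRadial d u u' g) {R : ℝ} (hR : 0 < R)
    (hg : ∀ r ∈ Ioo 0 R, 0 ≤ g r) : 0 ≤ u' R := by
  have hmono := hu.flux_monotoneOn le_rfl hg
  have h0 : 0 ≤ R ^ (d - 1) * u' R := by
    refine le_of_tendsto hu.flux_tendsto ?_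
    filter_upwards [Ioc_mem_nhdsGT hR] with s hs
    exact hmono hs ⟨hR, le_rfl⟩ hs.2
  exact nonneg_of_mul_nonneg_right h0 (by positivity)

/-- The flux vanishes at 0 only as a limit, so strictness is gained on [R/2, R], away from the
origin. -/
theorem deriv_pos (hu : IsRadial d u u' g) {R : ℝ} (hR : 0 < R)
    (hg : ∀ r ∈ Ioo 0 R, 0 < g r) : 0 < u' R := by
  have h1 : 0 ≤ u' (R / 2) := hu.deriv_nonneg (by positivity)
    fun r hr => (hg r ⟨hr.1, by linarith [hr.2]⟩).le
  have h2 := hu.flux_strictMonoOn (a := R / 2) (R := R) (by positivity)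
    (fun r hr => hg r ⟨by linarith [hr.1], hr.2⟩) ⟨le_rfl, by linarith⟩ ⟨by linarith, le_rfl⟩
    (by linarith)
  have h3 : 0 < R ^ (d - 1) * u' R := lt_of_le_of_lt (by positivity) h2
  exact pos_of_mul_pos_right h3 (by positivity)

theorem monotoneOn_of_deriv_nonneg (hu : IsRadial d u u' g) {a R : ℝ} (ha : 0 ≤ a)
    (h : ∀ r ∈ Ioo a R, 0 ≤ u' r) : MonotoneOn u (Icc a R) := by
  refine monotoneOn_of_hasDerivWithinAt_nonneg (convex_Icc a R)
    (hu.continuousOn.mono fun x hx => ha.trans hx.1) (f' := u') ?_ ?_ <;> intro x hx <;>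
    rw [interior_Icc] at hx
  · exact (hu.hasDerivAt x (ha.trans_lt hx.1)).hasDerivWithinAt
  · exact h x hx

theorem strictMonoOn_of_deriv_pos (hu : IsRadial d u u' g) {a R : ℝ} (ha : 0 ≤ a)
    (h : ∀ r ∈ Ioo a R, 0 < u' r) : StrictMonoOn u (Icc a R) := by
  refine strictMonoOn_of_hasDerivWithinAt_pos (convex_Icc a R)
    (hu.continuousOn.mono fun x hx => ha.trans hx.1) (f' := u') ?_ ?_ <;> intro x hx <;>
    rw [interior_Icc] at hx
  · exact (hu.hasDerivAt x (ha.trans_lt hx.1)).hasDerivWithinAt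
  · exact h x hx

theorem monotoneOn (hu : IsRadial d u u' g) {R : ℝ} (hg : ∀ r ∈ Ioo 0 R, 0 ≤ g r) :
    MonotoneOn u (Icc 0 R) :=
  hu.monotoneOn_of_deriv_nonneg le_rfl fun _ hr =>
    hu.deriv_nonneg hr.1 fun s hs => hg s ⟨hs.1, hs.2.trans hr.2⟩

theorem strictMonoOn (hu : IsRadial d u u' g) {R : ℝ} (hg : ∀ r ∈ Ioo 0 R, 0 < g r) :
    StrictMonoOn u (Icc 0 R) :=
  hu.strictMonoOn_of_deriv_pos le_rfl fun _ hr =>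
    hu.deriv_pos hr.1 fun s hs => hg s ⟨hs.1, hs.2.trans hr.2⟩

theorem le_of_laplacian_nonneg (hu : IsRadial d u u' g) {R : ℝ} (hR : 0 ≤ R)
    (hg : ∀ r ∈ Ioo 0 R, 0 ≤ g r) : u 0 ≤ u R :=
  hu.monotoneOn hg ⟨le_rfl, hR⟩ ⟨hR, le_rfl⟩ hR

theorem le_of_le_laplacian (hu : IsRadial d u u' g) (hd : 0 < d) {R c : ℝ} (hR : 0 ≤ R)
    (hg : ∀ r ∈ Ioo 0 R, c ≤ g r) : u 0 + c * (R ^ 2 / (2 * d)) ≤ u R := by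
  have := (hu.sub ((sq hd).const_mul c)).le_of_laplacian_nonneg hR fun r hr => by
    simpa using hg r hr
  simp only [ne_eq, OfNat.ofNat_ne_zero, not_false_eq_true, zero_pow, zero_div, mul_zero,
    sub_zero] at this
  linarith

theorem le_of_laplacian_le (hu : IsRadial d u u' g) (hd : 0 < d) {R c : ℝ} (hR : 0 ≤ R)
    (hg : ∀ r ∈ Ioo 0 R, g r ≤ c) : u R ≤ u 0 + c * (R ^ 2 / (2 * d)) := by
  have := (hu.const_mul (-1)).le_of_le_laplacian hd hR (c := -c) fun r hr => by
    simpa using hg r hr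
  linarith

theorem abs_deriv_le (hu : IsRadial d u u' g) (hd : 0 < d) {R c : ℝ} (hR : 0 < R)
    (hg : ∀ r ∈ Ioo 0 R, |g r| ≤ c) : |u' R| ≤ c * (R / d) := by
  have h1 := (((sq hd).const_mul c).sub hu).deriv_nonneg hR fun r hr => by
    simpa using (abs_le.1 (hg r hr)).2
  have h2 := (((sq hd).const_mul c).add hu).deriv_nonneg hR fun r hr => by
    linarith [(abs_le.1 (hg r hr)).1]
  rw [abs_le]
  constructor <;> linarith

theorem of_contDiffOn (hd : 0 < d) (hu : ContDiffOn ℝ 2 u (Ici 0))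
    (h0 : derivWithin u (Ici 0) 0 = 0) (h : ∀ r, 0 < r → radialLaplacian d u r = g r) :
    IsRadial d u (deriv u) g := by
  have hev : ∀ r : ℝ, 0 < r → Ici (0 : ℝ) ∈ 𝓝 r := fun r hr => Ici_mem_nhds hr
  have hc : ∀ r, 0 < r → ContDiffAt ℝ 2 u r := fun r hr => hu.contDiffAt (hev r hr)
  have hD : ∀ r, 0 < r → derivWithin u (Ici 0) r = deriv u r := fun r hr =>
    derivWithin_of_mem_nhds (hev r hr)
  have hC1 : ContDiffOn ℝ 1 (derivWithin u (Ici 0)) (Ici 0) :=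
    hu.derivWithin (uniqueDiffOn_Ici 0) (by norm_num)
  refine ⟨hu.continuousOn, fun r hr => ?_, fun r hr => ?_, ?_⟩
  · exact ((hc r hr).differentiableAt (by norm_num)).hasDerivAt
  · have h1 : DifferentiableAt ℝ (deriv u) r := by
      refine ((hC1.contDiffAt (hev r hr)).differentiableAt (by norm_num)).congr_of_eventuallyEq ?_
      filter_upwards [Ioi_mem_nhds hr] with s hs
      exact (hD s hs).symm
    refine h1.hasDerivAt.congr_deriv ?_
    rw [← h r hr, radialLaplacian]
    ring
  -- For d < 1 the weight s^(d-1) blows up, so u'(0) = 0 alone does not suffice. The one-sided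
  -- second derivative at 0 does: the flux is s^d times the convergent quotient u'(s)/s.
  · have h1 := (hC1.differentiableOn (by norm_num) 0 self_mem_Ici).hasDerivWithinAt
    rw [hasDerivWithinAt_iff_tendsto_slope, Ici_sdiff_left] at h1
    have h2 : Tendsto (fun s : ℝ => s ^ d) (𝓝[>] 0) (𝓝 0) := by
      have := (Real.continuousAt_rpow_const 0 d (Or.inr hd.le)).tendsto.mono_left
        (nhdsWithin_le_nhds (s := Ioi 0))
      simpa [Real.zero_rpow hd.ne'] using this
    have h3 := h2.mul h1
    rw [zero_mul] at h3
    refine h3.congr' ?_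
    filter_upwards [self_mem_nhdsWithin] with s (hs : 0 < s)
    rw [slope_def_field, h0, hD s hs, Real.rpow_sub_one hs.ne']
    simp only [sub_zero]
    field_simp

end IsRadial

/-! ### Maximum principle and uniqueness for the initial value problem -/

/-- A continuous function positive at `0` stays positive if it can never vanish for the first
time. -/
theorem pos_of_no_first_zero {f : ℝ → ℝ} (hf : ContinuousOn f (Ici 0)) (h0 : 0 < f 0)
    (h : ∀ r, 0 < r → (∀ s, 0 ≤ s → s < r → 0 < f s) → 0 < f r) : ∀ r, 0 ≤ r → 0 < f r := by
  by_contra! hcon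
  obtain ⟨R, hR, hfR⟩ := hcon
  set S := Ici (0 : ℝ) ∩ f ⁻¹' Iic 0
  have hS : IsClosed S := hf.preimage_isClosed_of_isClosed isClosed_Ici isClosed_Iic
  have hne : S.Nonempty := ⟨R, hR, hfR⟩
  have hbd : BddBelow S := ⟨0, fun x hx => hx.1⟩
  obtain ⟨hm0, hm⟩ := hS.csInf_mem hne hbd
  have hpos : 0 < sInf S := by
    refine lt_of_le_of_ne hm0 fun heq => ?_
    rw [← heq] at hm
    exact absurd h0 (not_lt.2 hm)
  refine absurd (h _ hpos fun s hs hlt => ?_) (not_lt.2 hm)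
  by_contra! hle
  exact absurd (csInf_le hbd ⟨hs, hle⟩) (not_le.2 hlt)

namespace IsRadial

variable {d : ℝ} {u u' g v v' h : ℝ → ℝ}

/-- As long as u is positive its Laplacian is nonnegative, so u stays above u(0) and can never reach
a first zero. -/
theorem le_of_mul_le_laplacian (hu : IsRadial d u u' g) {c : ℝ → ℝ} (hc : ∀ r, 0 < r → 0 ≤ c r)
    (h0 : 0 < u 0) (hg : ∀ r, 0 < r → c r * u r ≤ g r) : ∀ r, 0 ≤ r → u 0 ≤ u r := by
  have key : ∀ r, 0 < r → (∀ s, 0 ≤ s → s < r → 0 < u s) → u 0 ≤ u r := fun r hr hs =>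
    hu.le_of_laplacian_nonneg hr.le fun s h =>
      (mul_nonneg (hc s h.1) (hs s h.1.le h.2).le).trans (hg s h.1)
  have hpos := pos_of_no_first_zero hu.continuousOn h0 fun r hr hs => h0.trans_le (key r hr hs)
  intro r hr
  rcases hr.eq_or_lt with rfl | hr
  · exact le_rfl
  · exact key r hr fun s hs _ => hpos s hs

/-- In the sup norm with weight exp(-l r), integrating the inequalities twice gains a factor 1/4 for
each function. The weighted norm M of the pair then satisfies M ≤ M/2. -/
theorem eq_zero_of_abs_laplacian_le (hd : 0 < d) (hu : IsRadial d u u' g)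
    (hv : IsRadial d v v' h) (hu0 : u 0 = 0) (hv0 : v 0 = 0) {L R : ℝ} (hL : 0 < L) (hR : 0 < R)
    (hg : ∀ r ∈ Ioo 0 R, |g r| ≤ L * (|u r| + |v r|))
    (hh : ∀ r ∈ Ioo 0 R, |h r| ≤ L * (|u r| + |v r|)) :
    ∀ r ∈ Icc 0 R, u r = 0 ∧ v r = 0 := by
  -- Chosen so that L R / d = l / 4, the bound on the derivative being L M exp(l s) s / d.
  set l : ℝ := 4 * L * R / d
  have hl : 0 < l := by positivity
  set q : ℝ → ℝ := fun r => Real.exp (-l * r) * (|u r| + |v r|)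
  have hq : ContinuousOn q (Icc 0 R) := by
    have h1 : ContinuousOn u (Icc 0 R) := hu.continuousOn.mono Icc_subset_Ici_self
    have h2 : ContinuousOn v (Icc 0 R) := hv.continuousOn.mono Icc_subset_Ici_self
    exact (by fun_prop : ContinuousOn (fun r => Real.exp (-l * r)) (Icc 0 R)).mul
      (h1.abs.add h2.abs)
  obtain ⟨x, hx, hmax⟩ := isCompact_Icc.exists_isMaxOn ⟨0, left_mem_Icc.2 hR.le⟩ hq
  set M := q x
  have hM : 0 ≤ M := by positivity
  have hle : ∀ r ∈ Icc 0 R, |u r| + |v r| ≤ M * Real.exp (l * r) := by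
    intro r hr
    have h1 : q r ≤ M := hmax hr
    have h2 : q r * Real.exp (l * r) = |u r| + |v r| := by
      simp only [q]
      rw [mul_right_comm, ← Real.exp_add]
      simp
    rw [← h2]
    gcongr
  have bound : ∀ {w w' k : ℝ → ℝ}, IsRadial d w w' k → w 0 = 0 →
      (∀ r ∈ Ioo 0 R, |k r| ≤ L * (|u r| + |v r|)) →
      ∀ r ∈ Icc 0 R, |w r| ≤ M / 4 * Real.exp (l * r) := by
    intro w w' k hw hw0 hk r hr
    have hw' : ∀ s ∈ Ioo 0 R, |w' s| ≤ M / 4 * (l * Real.exp (l * s)) := by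
      intro s hs
      have h1 := hw.abs_deriv_le hd (c := L * (M * Real.exp (l * s))) hs.1 fun t ht => by
        refine (hk t ⟨ht.1, ht.2.trans hs.2⟩).trans ?_
        gcongr
        refine (hle t ⟨ht.1.le, (ht.2.trans hs.2).le⟩).trans ?_
        gcongr
        exact ht.2.le
      refine h1.trans ?_
      have h2 : M / 4 * (l * Real.exp (l * s)) = L * (M * Real.exp (l * s)) * (R / d) := by
        simp only [l]; field_simp
      rw [h2]
      gcongr
      exact hs.2.le
    have hE : ∀ s : ℝ, HasDerivAt (fun s => M / 4 * Real.exp (l * s))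
        (M / 4 * (l * Real.exp (l * s))) s := fun s => by
      have := ((hasDerivAt_id s).const_mul l).exp.const_mul (M / 4)
      exact this.congr_deriv (by simp only [id]; ring)
    have hcE : Continuous fun s => M / 4 * Real.exp (l * s) := by fun_prop
    have hcw : ContinuousOn w (Icc 0 R) := hw.continuousOn.mono Icc_subset_Ici_self
    have m1 : MonotoneOn (fun s => M / 4 * Real.exp (l * s) - w s) (Icc 0 R) := by
      refine monotoneOn_of_hasDerivWithinAt_nonneg (convex_Icc 0 R) (hcE.continuousOn.sub hcw)
        (f' := fun s => M / 4 * (l * Real.exp (l * s)) - w' s) ?_ ?_ <;> intro s hs <;>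
        rw [interior_Icc] at hs
      · exact ((hE s).sub (hw.hasDerivAt s hs.1)).hasDerivWithinAt
      · exact sub_nonneg.2 (abs_le.1 (hw' s hs)).2
    have m2 : MonotoneOn (fun s => M / 4 * Real.exp (l * s) + w s) (Icc 0 R) := by
      refine monotoneOn_of_hasDerivWithinAt_nonneg (convex_Icc 0 R) (hcE.continuousOn.add hcw)
        (f' := fun s => M / 4 * (l * Real.exp (l * s)) + w' s) ?_ ?_ <;> intro s hs <;>
        rw [interior_Icc] at hs
      · exact ((hE s).add (hw.hasDerivAt s hs.1)).hasDerivWithinAt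
      · linarith [(abs_le.1 (hw' s hs)).1]
    have i1 := m1 (left_mem_Icc.2 hR.le) hr hr.1
    have i2 := m2 (left_mem_Icc.2 hR.le) hr hr.1
    simp only [hw0, mul_zero, Real.exp_zero, mul_one, sub_zero, add_zero] at i1 i2
    rw [abs_le]
    constructor <;> linarith
  have hMle : M ≤ M / 2 := by
    have h1 := bound hu hu0 hg x hx
    have h2 := bound hv hv0 hh x hx
    calc M = Real.exp (-l * x) * (|u x| + |v x|) := rfl
      _ ≤ Real.exp (-l * x) * (M / 2 * Real.exp (l * x)) := by
          gcongr
          linarith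
      _ = M / 2 := by
          rw [mul_left_comm, ← Real.exp_add]
          simp
  have hM0 : M = 0 := by linarith
  intro r hr
  have := hle r hr
  rw [hM0, zero_mul] at this
  have h1 := abs_nonneg (u r)
  have h2 := abs_nonneg (v r)
  exact ⟨abs_eq_zero.1 (by linarith), abs_eq_zero.1 (by linarith)⟩

end IsRadial

/-! ### Global solutions by contraction -/

section RadialFlow

variable {E : Type*} [NormedAddCommGroup E] [NormedSpace ℝ E]

/-- The weighted mean `∫ σ in 0..1, σ ^ (d - 1) • G (t * σ)`, after the substitution `x = σ ^ d`. -/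
noncomputable def radialMean (d : ℝ) (G : ℝ → E) (t : ℝ) : E :=
  d⁻¹ • ∫ x in (0 : ℝ)..1, G (t * x ^ d⁻¹)

/-- The inverse of the radial Laplacian with vanishing data at the origin. -/
noncomputable def radialInverse (d : ℝ) (G : ℝ → E) (r : ℝ) : E :=
  ∫ t in (0 : ℝ)..r, t • radialMean d G t

variable {d : ℝ} {G H : ℝ → E}

theorem continuous_rpow_inv (hd : 0 < d) : Continuous fun x : ℝ => x ^ d⁻¹ :=
  Real.continuous_rpow_const (inv_nonneg.2 hd.le)

theorem continuous_radialMean (hd : 0 < d) (hG : Continuous G) : Continuous (radialMean d G) := by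
  refine Continuous.const_smul ?_ _
  refine intervalIntegral.continuous_parametric_intervalIntegral_of_continuous' ?_ 0 1
  exact hG.comp (continuous_fst.mul ((continuous_rpow_inv hd).comp continuous_snd))

theorem norm_radialMean_sub_le (hd : 0 < d) (hG : Continuous G) (hH : Continuous H) {t M : ℝ}
    (ht : 0 ≤ t) (h : ∀ s ∈ Icc 0 t, ‖G s - H s‖ ≤ M) :
    ‖radialMean d G t - radialMean d H t‖ ≤ M / d := by
  have hc := continuous_rpow_inv hd
  rw [radialMean, radialMean, ← smul_sub, ← intervalIntegral.integral_sub, norm_smul]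
  · have h1 : ‖∫ x in (0 : ℝ)..1, (G (t * x ^ d⁻¹) - H (t * x ^ d⁻¹))‖ ≤ M * |1 - 0| := by
      refine intervalIntegral.norm_integral_le_of_norm_le_const fun x hx => ?_
      rw [uIoc_of_le zero_le_one] at hx
      have h2 : x ^ d⁻¹ ≤ 1 := Real.rpow_le_one hx.1.le hx.2 (inv_nonneg.2 hd.le)
      have h3 : 0 ≤ x ^ d⁻¹ := Real.rpow_nonneg hx.1.le _
      exact h _ ⟨by positivity, mul_le_of_le_one_right ht h2⟩
    rw [Real.norm_of_nonneg (inv_nonneg.2 hd.le), div_eq_inv_mul]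
    gcongr
    simpa using h1
  · exact (hG.comp (continuous_const.mul hc)).intervalIntegrable _ _
  · exact (hH.comp (continuous_const.mul hc)).intervalIntegrable _ _

theorem radialMean_neg (G : ℝ → E) (t : ℝ) :
    radialMean d (fun s => G (-s)) t = radialMean d G (-t) := by
  simp [radialMean]

/-- The exponent has derivative 2 (C/d) s (1 + s^2), so the weight absorbs exactly the growing
Lipschitz constant C (1 + s^2) and leaves the contraction factor 1/2. -/
theorem norm_radialInverse_sub_le (hd : 0 < d) (hG : Continuous G) (hH : Continuous H) {C N : ℝ}
    (hC : 0 ≤ C) (hN : 0 ≤ N)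
    (h : ∀ s, 0 ≤ s → ‖G s - H s‖ ≤
      C * (1 + s ^ 2) * (N * Real.exp (C / d * (s ^ 2 + s ^ 4 / 2)))) {r : ℝ} (hr : 0 ≤ r) :
    ‖radialInverse d G r - radialInverse d H r‖ ≤
      N / 2 * Real.exp (C / d * (r ^ 2 + r ^ 4 / 2)) := by
  set e : ℝ → ℝ := fun s => N / 2 * Real.exp (C / d * (s ^ 2 + s ^ 4 / 2))
  set e' : ℝ → ℝ := fun s => s * (C * (1 + s ^ 2) *
    (N * Real.exp (C / d * (s ^ 2 + s ^ 4 / 2))) / d)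
  have he : ∀ s, HasDerivAt e (e' s) s := fun s => by
    have h1 := ((((hasDerivAt_pow 2 s).add ((hasDerivAt_pow 4 s).div_const 2)).const_mul
      (C / d)).exp).const_mul (N / 2)
    refine h1.congr_deriv ?_
    simp only [e', Pi.add_apply]
    field_simp
    norm_num
    ring
  have hec : Continuous e' := by fun_prop
  have hcG : Continuous fun t => t • radialMean d G t :=
    continuous_id.smul (continuous_radialMean hd hG)
  have hcH : Continuous fun t => t • radialMean d H t :=
    continuous_id.smul (continuous_radialMean hd hH)
  rw [radialInverse, radialInverse, ← intervalIntegral.integral_sub (hcG.intervalIntegrable _ _)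
    (hcH.intervalIntegrable _ _)]
  have hb : ‖∫ t in (0 : ℝ)..r, (t • radialMean d G t - t • radialMean d H t)‖ ≤
      ∫ t in (0 : ℝ)..r, e' t := by
    refine intervalIntegral.norm_integral_le_of_norm_le hr (Eventually.of_forall fun t ht => ?_)
      (hec.intervalIntegrable _ _)
    rw [← smul_sub, norm_smul, Real.norm_of_nonneg ht.1.le]
    refine mul_le_mul_of_nonneg_left ?_ ht.1.le
    refine norm_radialMean_sub_le hd hG hH ht.1.le fun s hs => (h s hs.1).trans ?_
    have h0 := hs.1
    have h1 := hs.2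
    gcongr
  refine hb.trans ?_
  rw [intervalIntegral.integral_eq_sub_of_hasDerivAt (fun s _ => he s)
    (hec.intervalIntegrable _ _)]
  exact sub_le_self _ (by positivity : 0 ≤ e 0)

variable [CompleteSpace E]

theorem radialMean_zero (G : ℝ → E) : radialMean d G 0 = d⁻¹ • G 0 := by
  simp [radialMean]

/-- Rescaling turns t^d times the mean into a primitive evaluated at t^d, to which the fundamental
theorem of calculus applies. -/
theorem hasDerivAt_smul_radialMean_of_pos (hd : 0 < d) (hG : Continuous G) {t : ℝ} (ht : 0 < t) :
    HasDerivAt (fun t => t • radialMean d G t) (G t - (d - 1) • radialMean d G t) t := by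
  set J : ℝ → E := fun y => ∫ x in (0 : ℝ)..y, G (x ^ d⁻¹)
  have hcont : Continuous fun x : ℝ => G (x ^ d⁻¹) := hG.comp (continuous_rpow_inv hd)
  have hJ : HasDerivAt J (G ((t ^ d) ^ d⁻¹)) (t ^ d) :=
    intervalIntegral.integral_hasDerivAt_right (hcont.intervalIntegrable _ _)
      (hcont.stronglyMeasurableAtFilter _ _) hcont.continuousAt
  rw [Real.rpow_rpow_inv ht.le hd.ne'] at hJ
  have hA : ∀ s : ℝ, 0 < s → s ^ d • radialMean d G s = d⁻¹ • J (s ^ d) := by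
    intro s hs
    have h1 := intervalIntegral.smul_integral_comp_mul_left (a := 0) (b := 1)
      (fun y => G (y ^ d⁻¹)) (s ^ d)
    rw [mul_zero, mul_one] at h1
    simp only [J, radialMean]
    rw [← h1, smul_comm]
    congr 2
    refine intervalIntegral.integral_congr fun x hx => ?_
    rw [uIcc_of_le zero_le_one] at hx
    rw [Real.mul_rpow (Real.rpow_nonneg hs.le _) hx.1, Real.rpow_rpow_inv hs.le hd.ne']
  have hD : HasDerivAt (fun s : ℝ => s ^ (1 - d) • (d⁻¹ • J (s ^ d)))
      (t ^ (1 - d) • (d⁻¹ • ((d * t ^ (d - 1)) • G t)) +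
        ((1 - d) * t ^ (1 - d - 1)) • (d⁻¹ • J (t ^ d))) t := by
    have h2 := Real.hasDerivAt_rpow_const (p := d) (Or.inl ht.ne')
    have h3 := Real.hasDerivAt_rpow_const (p := 1 - d) (Or.inl ht.ne')
    exact h3.smul ((hJ.scomp t h2).const_smul d⁻¹)
  have hEq : (fun t => t • radialMean d G t) =ᶠ[𝓝 t] fun s : ℝ => s ^ (1 - d) • (d⁻¹ • J (s ^ d)) := by
    filter_upwards [Ioi_mem_nhds ht] with s (hs : 0 < s)
    rw [← hA s hs, smul_smul, ← Real.rpow_add hs]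
    simp
  refine (hD.congr_of_eventuallyEq hEq).congr_deriv ?_
  rw [← hA t ht]
  simp only [smul_smul]
  have e1 : t ^ (1 - d) * (d⁻¹ * (d * t ^ (d - 1))) = 1 := by
    rw [inv_mul_cancel_left₀ hd.ne', ← Real.rpow_add ht]
    simp
  have e2 : (1 - d) * t ^ (1 - d - 1) * t ^ d = 1 - d := by
    rw [mul_assoc, ← Real.rpow_add ht]
    simp
  rw [e1, e2, one_smul, sub_smul, sub_smul]
  abel

theorem hasDerivAt_smul_radialMean (hd : 0 < d) (hG : Continuous G) (t : ℝ) :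
    HasDerivAt (fun t => t • radialMean d G t) (G t - (d - 1) • radialMean d G t) t := by
  rcases lt_trichotomy t 0 with ht | rfl | ht
  -- Negative t reduces to positive t by reflecting `G`; at 0 the difference quotient is the mean
  -- itself, which is continuous.
  · have h1 := hasDerivAt_smul_radialMean_of_pos hd (hG.comp continuous_neg) (neg_pos.2 ht)
    have h2 := (h1.scomp t (hasDerivAt_neg t)).neg
    refine (h2.congr_of_eventuallyEq (Eventually.of_forall fun s => ?_)).congr_deriv ?_
    · simp [Function.comp_def, radialMean_neg]
    · simp [Function.comp_def, radialMean_neg]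
  · rw [radialMean_zero, hasDerivAt_iff_tendsto_slope]
    have h1 := ((continuous_radialMean hd hG).tendsto 0).mono_left
      (nhdsWithin_le_nhds (s := {0}ᶜ))
    rw [radialMean_zero] at h1
    have h2 : G 0 - (d - 1) • d⁻¹ • G 0 = d⁻¹ • G 0 := by
      rw [smul_smul, sub_mul, mul_inv_cancel₀ hd.ne', sub_smul]
      simp
    rw [h2]
    refine h1.congr' ?_
    filter_upwards [self_mem_nhdsWithin] with s hs
    simp [slope, smul_smul, inv_mul_cancel₀ (show s ≠ 0 from hs)]
  · exact hasDerivAt_smul_radialMean_of_pos hd hG ht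

theorem hasDerivAt_radialInverse (hd : 0 < d) (hG : Continuous G) (r : ℝ) :
    HasDerivAt (radialInverse d G) (r • radialMean d G r) r := by
  have hc : Continuous fun t => t • radialMean d G t :=
    continuous_id.smul (continuous_radialMean hd hG)
  exact intervalIntegral.integral_hasDerivAt_right (hc.intervalIntegrable _ _)
    (hc.stronglyMeasurableAtFilter _ _) hc.continuousAt

theorem deriv_radialInverse (hd : 0 < d) (hG : Continuous G) :
    deriv (radialInverse d G) = fun r => r • radialMean d G r :=
  funext fun r => (hasDerivAt_radialInverse hd hG r).deriv

theorem contDiff_radialInverse (hd : 0 < d) (hG : Continuous G) :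
    ContDiff ℝ 2 (radialInverse d G) := by
  rw [show (2 : WithTop ℕ∞) = 1 + 1 by norm_num, contDiff_succ_iff_deriv]
  refine ⟨fun r => (hasDerivAt_radialInverse hd hG r).differentiableAt, by simp, ?_⟩
  rw [deriv_radialInverse hd hG, contDiff_one_iff_deriv]
  refine ⟨fun r => (hasDerivAt_smul_radialMean hd hG r).differentiableAt, ?_⟩
  rw [show deriv (fun r => r • radialMean d G r) = fun t => G t - (d - 1) • radialMean d G t from
    funext fun r => (hasDerivAt_smul_radialMean hd hG r).deriv]
  exact hG.sub ((continuous_radialMean hd hG).const_smul _)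

/-- Global solvability of the radial initial value problem for a nonlinearity that is globally
Lipschitz in the unknown, with Lipschitz dependence on the initial value. -/
theorem exists_radial_flow (hd : 0 < d) {F : ℝ → E → E} (hF : Continuous (Function.uncurry F))
    (hF0 : ∀ t, F t 0 = 0) {C : ℝ} (hC : 0 ≤ C)
    (hL : ∀ t x y, ‖F t x - F t y‖ ≤ C * (1 + t ^ 2) * ‖x - y‖) :
    ∃ Y : E → ℝ → E, (∀ p, ContDiff ℝ 2 (Y p) ∧ Y p 0 = p ∧ deriv (Y p) 0 = 0 ∧
      ∀ r, 0 < r → deriv (deriv (Y p)) r + ((d - 1) / r) • deriv (Y p) r = F r (Y p r)) ∧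
      ∀ R, ∃ K, ∀ p q, ∀ r ∈ Icc 0 R, ‖Y p r - Y q r‖ ≤ K * ‖p - q‖ := by
  set w : ℝ → ℝ := fun r => C / d * (r ^ 2 + r ^ 4 / 2)
  have hw : Continuous w := by fun_prop
  have hw0 : ∀ r, 0 ≤ w r := fun r => by positivity
  have hwabs : ∀ r, w |r| = w r := fun r => by
    simp only [w, sq_abs]
    rw [show |r| ^ 4 = (|r| ^ 2) ^ 2 by ring, sq_abs]
    ring
  -- the nonlinearity along a weighted function
  set N : (ℝ →ᵇ E) → ℝ → E := fun z s => F s (Real.exp (w s) • z s)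
  have hN : ∀ z, Continuous (N z) := fun z =>
    hF.comp (continuous_id.prodMk ((Real.continuous_exp.comp hw).smul z.continuous))
  have hNsub : ∀ z y : ℝ →ᵇ E, ∀ s, ‖N z s - N y s‖ ≤
      C * (1 + s ^ 2) * (‖z - y‖ * Real.exp (w s)) := fun z y s => by
    refine (hL _ _ _).trans ?_
    rw [← smul_sub, norm_smul, Real.norm_of_nonneg (Real.exp_pos _).le, mul_comm ‖z - y‖]
    gcongr
    exact (z - y).norm_coe_le_norm s
  have hS : ∀ z y : ℝ →ᵇ E, ∀ r, 0 ≤ r →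
      ‖radialInverse d (N z) r - radialInverse d (N y) r‖ ≤ ‖z - y‖ / 2 * Real.exp (w r) :=
    fun z y r hr => norm_radialInverse_sub_le hd (hN z) (hN y) hC (norm_nonneg _)
      (fun s _ => hNsub z y s) hr
  have hzero : radialInverse d (N 0) = 0 := by
    funext r
    simp [radialInverse, radialMean, N, hF0]
  have hScont : ∀ z, Continuous (radialInverse d (N z)) := fun z =>
    (contDiff_radialInverse hd (hN z)).continuous
  have hscale : ∀ (r : ℝ) (x : E) (b : ℝ), ‖x‖ ≤ b * Real.exp (w r) →
      ‖Real.exp (-w r) • x‖ ≤ b := fun r x b hx => by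
    rw [norm_smul, Real.norm_of_nonneg (Real.exp_pos _).le]
    calc Real.exp (-w r) * ‖x‖ ≤ Real.exp (-w r) * (b * Real.exp (w r)) := by gcongr
      _ = b := by rw [mul_left_comm, ← Real.exp_add]; simp
  have hscale1 : ∀ (r : ℝ) (p : E), ‖Real.exp (-w r) • p‖ ≤ ‖p‖ := fun r p =>
    hscale r p _ (le_mul_of_one_le_right (norm_nonneg _) (Real.one_le_exp (hw0 r)))
  have hSabs : ∀ z y : ℝ →ᵇ E, ∀ r, ‖Real.exp (-w r) •
      (radialInverse d (N z) |r| - radialInverse d (N y) |r|)‖ ≤ ‖z - y‖ / 2 := fun z y r => by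
    refine hscale r _ _ ?_
    have := hS z y |r| (abs_nonneg r)
    rwa [hwabs] at this
  -- The unknown is z = exp(-w) Y, bounded even though Y may grow. Using |r| extends it evenly, so
  -- that the space of bounded continuous functions on the whole line can be used.
  let T : E → (ℝ →ᵇ E) → (ℝ →ᵇ E) := fun p z =>
    BoundedContinuousFunction.ofNormedAddCommGroup
      (fun r => Real.exp (-w r) • (p + radialInverse d (N z) |r|))
      ((Real.continuous_exp.comp hw.neg).smul
        (continuous_const.add ((hScont z).comp continuous_abs)))
      (‖p‖ + ‖z‖ / 2) fun r => by
        rw [smul_add]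
        refine (norm_add_le _ _).trans (add_le_add (hscale1 r p) ?_)
        have := hSabs z 0 r
        simpa [hzero] using this
  have hTapp : ∀ p z r, T p z r = Real.exp (-w r) • (p + radialInverse d (N z) |r|) :=
    fun p z r => rfl
  have hT : ∀ p, ContractingWith (1 / 2) (T p) := fun p => by
    refine ⟨by norm_num, LipschitzWith.of_dist_le_mul fun z y => ?_⟩
    rw [dist_eq_norm, dist_eq_norm]
    refine (BoundedContinuousFunction.norm_le (by positivity)).2 fun r => ?_
    rw [BoundedContinuousFunction.sub_apply, hTapp, hTapp, ← smul_sub, add_sub_add_left_eq_sub]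
    refine (hSabs z y r).trans (le_of_eq ?_)
    simp
    ring
  let Z : E → (ℝ →ᵇ E) := fun p => (hT p).fixedPoint (T p)
  have hZ : ∀ p, T p (Z p) = Z p := fun p => (hT p).fixedPoint_isFixedPt
  -- Subtract the two fixed point equations and absorb the contracted half on the left.
  have hZd : ∀ p q, ‖Z p - Z q‖ ≤ 2 * ‖p - q‖ := fun p q => by
    have h1 : ‖T p (Z p) - T q (Z q)‖ ≤ ‖p - q‖ + ‖Z p - Z q‖ / 2 := by
      refine (BoundedContinuousFunction.norm_le (by positivity)).2 fun r => ?_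
      rw [BoundedContinuousFunction.sub_apply, hTapp, hTapp, ← smul_sub, add_sub_add_comm,
        smul_add]
      exact (norm_add_le _ _).trans (add_le_add (hscale1 r _) (hSabs _ _ r))
    rw [hZ, hZ] at h1
    linarith
  let Y : E → ℝ → E := fun p r => p + radialInverse d (N (Z p)) r
  have hYZ : ∀ p r, 0 ≤ r → Y p r = Real.exp (w r) • Z p r := fun p r hr => by
    have h1 : Z p r = Real.exp (-w r) • (p + radialInverse d (N (Z p)) |r|) := by
      rw [← hTapp, hZ]
    rw [h1, smul_smul, ← Real.exp_add, abs_of_nonneg hr]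
    simp [Y]
  have hYd : ∀ p, deriv (Y p) = fun r => r • radialMean d (N (Z p)) r := fun p =>
    funext fun r => ((hasDerivAt_radialInverse hd (hN (Z p)) r).const_add p).deriv
  refine ⟨Y, fun p => ⟨contDiff_const.add (contDiff_radialInverse hd (hN _)), ?_, ?_, ?_⟩, ?_⟩
  · simp [Y, radialInverse]
  · simp [hYd]
  · intro r hr
    rw [hYd, (hasDerivAt_smul_radialMean hd (hN _) r).deriv, hYZ p r hr.le]
    simp only
    rw [smul_smul, div_mul_cancel₀ _ hr.ne', sub_add_cancel]
  · intro R
    refine ⟨2 * Real.exp (w R), fun p q r hr => ?_⟩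
    rw [hYZ p r hr.1, hYZ q r hr.1, ← smul_sub, norm_smul, Real.norm_of_nonneg (Real.exp_pos _).le]
    have h1 : w r ≤ w R := by
      have h0 := hr.1
      have h1 := hr.2
      simp only [w]
      gcongr
    calc Real.exp (w r) * ‖Z p r - Z q r‖ ≤ Real.exp (w R) * (2 * ‖p - q‖) := by
          gcongr
          exact ((Z p - Z q).norm_coe_le_norm r).trans (hZd p q)
      _ = 2 * Real.exp (w R) * ‖p - q‖ := by ring

end RadialFlow

/-! ### Decay estimates and the weighted Wronskian -/

namespace IsRadial

variable {d : ℝ} {u u' g v v' h : ℝ → ℝ}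

/-- A positive function with `Δu ≤ -k u` would decay exponentially, whereas a positive
superharmonic function decays at most polynomially. -/
theorem not_pos_of_laplacian_le (hu : IsRadial d u u' g) (hd : 0 < d) {k : ℝ} (hk : 0 < k)
    (hpos : ∀ r, 0 < r → 0 < u r) (hg : ∀ r, 0 < r → g r ≤ -k * u r) : False := by
  have hneg := hu.const_mul (-1)
  have hg0 : ∀ r, 0 < r → 0 ≤ -1 * g r := fun r hr => by
    nlinarith [hg r hr, mul_pos hk (hpos r hr)]
  have hanti : ∀ s r, 0 < s → s ≤ r → u r ≤ u s := fun s r hs hsr => by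
    have := hneg.monotoneOn (R := r) (fun x hx => hg0 x hx.1) ⟨hs.le, hsr⟩ ⟨hs.le.trans hsr, le_rfl⟩
      hsr
    simpa using this
  set a : ℝ := k / d
  have ha : 0 < a := by positivity
  -- Since u is nonincreasing, Δu ≤ -k u(r) on all of (0, r), and integrating gives u'(r) ≤ -k u(r)
  -- r/d.
  have hu' : ∀ r, 1 ≤ r → u' r ≤ -a * u r := by
    intro r hr
    have hr0 : 0 < r := by linarith
    have h1 := (((sq hd).const_mul (-k * u r)).sub hu).deriv_nonneg hr0 fun s hs => by
      have := hanti s r hs.1 hs.2.le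
      nlinarith [hg s hs.1]
    have h2 : k * u r * (1 / d) ≤ k * u r * (r / d) := by
      have := hpos r hr0
      gcongr
    have h3 : a * u r = k * u r * (1 / d) := by
      simp only [a]
      ring
    nlinarith
  have hexp : ∀ r, 1 ≤ r → u r * Real.exp (a * r) ≤ u 1 * Real.exp (a * 1) := by
    intro r hr
    have hD : ∀ s, 0 < s → HasDerivAt (fun s => u s * Real.exp (a * s))
        (u' s * Real.exp (a * s) + u s * (Real.exp (a * s) * (a * 1))) s := fun s hs =>
      (hu.hasDerivAt s hs).mul ((hasDerivAt_id s).const_mul a).exp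
    refine (antitoneOn_of_hasDerivWithinAt_nonpos (convex_Ici 1)
      (fun s hs => (hD s (zero_lt_one.trans_le hs)).continuousAt.continuousWithinAt)
      (fun s hs => (hD s ?_).hasDerivWithinAt) (fun s hs => ?_)) self_mem_Ici hr hr
    · rw [interior_Ici] at hs
      exact zero_lt_one.trans hs
    · rw [interior_Ici] at hs
      have := hu' s (le_of_lt hs)
      nlinarith [Real.exp_pos (a * s)]
  set m : ℝ := -u' 1
  have hm : 0 < m := by
    have h1 := hu' 1 le_rfl
    have h2 := hpos 1 one_pos
    have : 0 < a * u 1 := by positivity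
    simp only [m]
    linarith
  -- The outward flux -r^(d-1) u' is nondecreasing, hence at least its value m at 1; the mean value
  -- theorem on [r, r+1] turns this into a lower bound for u.
  have hlow : ∀ r, 1 ≤ r → m ≤ u r * (r + 1) ^ d := by
    intro r hr
    have hr0 : 0 < r := by linarith
    obtain ⟨x, hx, hxe⟩ := exists_hasDerivAt_eq_slope u u' (show r < r + 1 by linarith)
      (fun s hs => (hu.hasDerivAt s (hr0.trans_le hs.1)).continuousAt.continuousWithinAt)
      (fun s hs => hu.hasDerivAt s (hr0.trans hs.1))
    have hx0 : 0 < x := hr0.trans hx.1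
    have h1 := hneg.flux_monotoneOn (a := 0) (R := x) le_rfl (fun s hs => hg0 s hs.1)
      ⟨zero_lt_one, hr.trans hx.1.le⟩ ⟨hx0, le_rfl⟩ (hr.trans hx.1.le)
    simp only [Real.one_rpow, one_mul] at h1
    have h2 : u r - u (r + 1) = -u' x := by
      rw [hxe]
      ring
    have h3 : 0 ≤ -u' x := by
      rw [← h2]
      linarith [hanti r (r + 1) hr0 (by linarith)]
    have h4 : x ^ (d - 1) ≤ (r + 1) ^ d := by
      calc x ^ (d - 1) ≤ x ^ d :=
            Real.rpow_le_rpow_of_exponent_le (hr.trans hx.1.le) (by linarith)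
        _ ≤ (r + 1) ^ d := Real.rpow_le_rpow hx0.le hx.2.le hd.le
    calc m ≤ x ^ (d - 1) * (-u' x) := by simp only [m]; linarith
      _ ≤ (r + 1) ^ d * (-u' x) := by gcongr
      _ ≤ (r + 1) ^ d * u r := by
          gcongr
          linarith [hpos (r + 1) (by linarith)]
      _ = u r * (r + 1) ^ d := mul_comm _ _
  have hlim : Tendsto (fun r : ℝ => u 1 * Real.exp (a * 1) * Real.exp a *
      ((r + 1) ^ d * Real.exp (-a * (r + 1)))) atTop (𝓝 0) := by
    have h1 := (tendsto_rpow_mul_exp_neg_mul_atTop_nhds_zero d a ha).comp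
      (tendsto_atTop_add_const_right atTop (1 : ℝ) tendsto_id)
    simpa using h1.const_mul (u 1 * Real.exp (a * 1) * Real.exp a)
  refine absurd (ge_of_tendsto hlim ?_) (not_le.2 hm)
  filter_upwards [eventually_ge_atTop 1] with r hr
  refine (hlow r hr).trans ?_
  have h1 : u r = u r * Real.exp (a * r) * (Real.exp a * Real.exp (-a * (r + 1))) := by
    rw [mul_assoc, ← Real.exp_add, ← Real.exp_add]
    ring_nf
    simp
  have h2 : 0 < (r + 1) ^ d := Real.rpow_pos_of_pos (by linarith) _
  calc u r * (r + 1) ^ d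
      = u r * Real.exp (a * r) * (Real.exp a * Real.exp (-a * (r + 1))) * (r + 1) ^ d := by
        rw [← h1]
    _ ≤ u 1 * Real.exp (a * 1) * (Real.exp a * Real.exp (-a * (r + 1))) * (r + 1) ^ d := by
        exact mul_le_mul_of_nonneg_right
          (mul_le_mul_of_nonneg_right (hexp r hr) (by positivity)) h2.le
    _ = _ := by ring

theorem wronskian_hasDerivAt (hu : IsRadial d u u' g) (hv : IsRadial d v v' h) {r : ℝ}
    (hr : 0 < r) :
    HasDerivAt (fun s => s ^ (d - 1) * v' s * u s - v s * (s ^ (d - 1) * u' s))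
      (r ^ (d - 1) * (h r * u r - v r * g r)) r := by
  have := ((hv.flux_hasDerivAt hr).mul (hu.hasDerivAt r hr)).sub
    ((hv.hasDerivAt r hr).mul (hu.flux_hasDerivAt hr))
  exact this.congr_deriv (by ring)

theorem wronskian_tendsto (hu : IsRadial d u u' g) (hv : IsRadial d v v' h) :
    Tendsto (fun s => s ^ (d - 1) * v' s * u s - v s * (s ^ (d - 1) * u' s)) (𝓝[>] 0) (𝓝 0) := by
  have h1 := (hu.continuousOn 0 self_mem_Ici).mono Ioi_subset_Ici_self
  have h2 := (hv.continuousOn 0 self_mem_Ici).mono Ioi_subset_Ici_self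
  simpa using (hv.flux_tendsto.mul h1.tendsto).sub (h2.tendsto.mul hu.flux_tendsto)

theorem wronskian_monotoneOn (hu : IsRadial d u u' g) (hv : IsRadial d v v' h) {R : ℝ}
    (hgh : ∀ r ∈ Ioo 0 R, v r * g r ≤ h r * u r) :
    MonotoneOn (fun s => s ^ (d - 1) * v' s * u s - v s * (s ^ (d - 1) * u' s)) (Ioc 0 R) := by
  refine monotoneOn_of_hasDerivWithinAt_nonneg (convex_Ioc 0 R)
    (fun x hx => (hu.wronskian_hasDerivAt hv hx.1).continuousAt.continuousWithinAt)
    (f' := fun r => r ^ (d - 1) * (h r * u r - v r * g r)) ?_ ?_ <;> intro x hx <;>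
    rw [interior_Ioc] at hx
  · exact (hu.wronskian_hasDerivAt hv hx.1).hasDerivWithinAt
  · have := hx.1
    have := sub_nonneg.2 (hgh x hx)
    positivity

theorem wronskian_nonneg (hu : IsRadial d u u' g) (hv : IsRadial d v v' h) {R : ℝ} (hR : 0 < R)
    (hgh : ∀ r ∈ Ioo 0 R, v r * g r ≤ h r * u r) :
    0 ≤ R ^ (d - 1) * v' R * u R - v R * (R ^ (d - 1) * u' R) := by
  refine le_of_tendsto (hu.wronskian_tendsto hv) ?_
  filter_upwards [Ioc_mem_nhdsGT hR] with s hs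
  exact hu.wronskian_monotoneOn hv hgh hs ⟨hR, le_rfl⟩ hs.2

theorem wronskian_pos (hu : IsRadial d u u' g) (hv : IsRadial d v v' h) {R : ℝ} (hR : 0 < R)
    (hgh : ∀ r ∈ Ioo 0 R, v r * g r < h r * u r) :
    0 < R ^ (d - 1) * v' R * u R - v R * (R ^ (d - 1) * u' R) := by
  have h1 := hu.wronskian_nonneg hv (R := R / 2) (by positivity)
    fun r hr => (hgh r ⟨hr.1, by linarith [hr.2]⟩).le
  refine h1.trans_lt ?_
  have hR2 : 0 < R / 2 := by positivity
  refine (strictMonoOn_of_hasDerivWithinAt_pos (convex_Icc (R / 2) R)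
    (f := fun s => s ^ (d - 1) * v' s * u s - v s * (s ^ (d - 1) * u' s))
    (f' := fun r => r ^ (d - 1) * (h r * u r - v r * g r))
    (fun x hx => (hu.wronskian_hasDerivAt hv
      (hR2.trans_le hx.1)).continuousAt.continuousWithinAt) ?_ ?_)
    ⟨le_rfl, by linarith⟩ ⟨by linarith, le_rfl⟩ (by linarith) <;> intro x hx <;>
    rw [interior_Icc] at hx <;> have hx0 := hR2.trans hx.1
  · exact (hu.wronskian_hasDerivAt hv hx0).hasDerivWithinAt
  · have := sub_pos.2 (hgh x ⟨hx0, hx.2⟩)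
    positivity

/-- The derivative of v/u is the Wronskian divided by r^(d-1) u^2. -/
theorem div_monotoneOn (hu : IsRadial d u u' g) (hv : IsRadial d v v' h) {R : ℝ}
    (hpos : ∀ r ∈ Icc 0 R, 0 < u r) (hgh : ∀ r ∈ Ioo 0 R, v r * g r ≤ h r * u r) :
    MonotoneOn (fun r => v r / u r) (Icc 0 R) := by
  have hcu : ContinuousOn u (Icc 0 R) := hu.continuousOn.mono Icc_subset_Ici_self
  have hcv : ContinuousOn v (Icc 0 R) := hv.continuousOn.mono Icc_subset_Ici_self
  refine monotoneOn_of_hasDerivWithinAt_nonneg (convex_Icc 0 R)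
    (hcv.div hcu fun r hr => (hpos r hr).ne')
    (f' := fun r => (v' r * u r - v r * u' r) / u r ^ 2) ?_ ?_ <;> intro r hr <;>
    rw [interior_Icc] at hr
  · exact ((hv.hasDerivAt r hr.1).div (hu.hasDerivAt r hr.1)
      (hpos r (Ioo_subset_Icc_self hr)).ne').hasDerivWithinAt
  · have h1 := hu.wronskian_nonneg hv hr.1 fun s hs => hgh s ⟨hs.1, hs.2.trans hr.2⟩
    have h2 : 0 ≤ r ^ (d - 1) * (v' r * u r - v r * u' r) := by linarith
    have h3 := nonneg_of_mul_nonneg_right h2 (Real.rpow_pos_of_pos hr.1 _)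
    positivity

/-- Beyond R the flux is negative and nondecreasing, so over any unit interval there it rises by at
most its absolute value at R. Its derivative x^(d-1) Δu(x) is therefore bounded at some point x of
each such interval, and Δu dominates u. -/
theorem flux_decay (hu : IsRadial d u u' g) (hd : 0 < d) {c R : ℝ} (hc : 0 < c) (hR : 0 < R)
    (hpos : ∀ r, 0 < r → 0 < u r) (hneg : ∀ r, 0 < r → u' r < 0)
    (hg : ∀ r, R ≤ r → c * u r ≤ g r) :
    ∃ C, 0 < C ∧ ∀ r, R + 2 ≤ r → r ^ (d - 1) * u r ≤ C := by
  set f : ℝ → ℝ := fun s => s ^ (d - 1) * u' s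
  have hfneg : ∀ r, 0 < r → f r < 0 := fun r hr =>
    mul_neg_of_pos_of_neg (Real.rpow_pos_of_pos hr _) (hneg r hr)
  refine ⟨2 ^ d * (-f R) / c, ?_, fun r hr => ?_⟩
  · have := hfneg R hR
    have : 0 < -f R := by linarith
    positivity
  have hr0 : 0 < r := by linarith
  obtain ⟨x, hx, hxe⟩ := exists_hasDerivAt_eq_slope f (fun s => s ^ (d - 1) * g s)
    (show r - 1 < r by linarith)
    (fun s hs => (hu.flux_hasDerivAt (by linarith [hs.1])).continuousAt.continuousWithinAt)
    (fun s hs => hu.flux_hasDerivAt (by linarith [hs.1]))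
  have hx0 : 0 < x := by linarith [hx.1]
  have hmono : f R ≤ f (r - 1) := by
    refine (monotoneOn_of_hasDerivWithinAt_nonneg (convex_Ici R)
      (fun s hs => (hu.flux_hasDerivAt (hR.trans_le hs)).continuousAt.continuousWithinAt)
      (f' := fun s => s ^ (d - 1) * g s) ?_ ?_) self_mem_Ici
      (show R ≤ r - 1 by linarith) (by linarith) <;> intro s hs <;> rw [interior_Ici] at hs
    · exact (hu.flux_hasDerivAt (hR.trans hs)).hasDerivWithinAt
    · have h0 := hR.trans hs
      have h1 := hg s (le_of_lt hs)
      have h2 := hpos s h0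
      have : 0 ≤ g s := le_trans (by positivity) h1
      positivity
  have h1 : x ^ (d - 1) * g x ≤ -f R := by
    rw [hxe, sub_sub_cancel, div_one]
    linarith [hfneg r hr0]
  have hux : u r ≤ u x := by
    have := (hu.const_mul (-1)).monotoneOn_of_deriv_nonneg (a := x) (R := r) hx0.le
      (fun s hs => by linarith [hneg s (hx0.trans hs.1)]) ⟨le_rfl, hx.2.le⟩ ⟨hx.2.le, le_rfl⟩ hx.2.le
    linarith
  -- Here r/2 ≤ x < r. Comparing r^d/r with x^d/x avoids a case split on the sign of d - 1.
  have h2 : r ^ (d - 1) ≤ 2 ^ d * x ^ (d - 1) := by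
    have h3 : r ^ d ≤ (2 * x) ^ d := Real.rpow_le_rpow hr0.le (by linarith [hx.1]) hd.le
    rw [Real.mul_rpow (by norm_num) hx0.le] at h3
    rw [Real.rpow_sub_one hr0.ne', Real.rpow_sub_one hx0.ne', ← mul_div_assoc]
    gcongr
    exact hx.2.le
  rw [le_div_iff₀ hc]
  have hur := hpos r hr0
  calc r ^ (d - 1) * u r * c = r ^ (d - 1) * (c * u r) := by ring
    _ ≤ 2 ^ d * x ^ (d - 1) * (c * u x) := by gcongr
    _ ≤ 2 ^ d * x ^ (d - 1) * g x := by
        gcongr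
        exact hg x (by linarith [hx.1])
    _ = 2 ^ d * (x ^ (d - 1) * g x) := by ring
    _ ≤ 2 ^ d * (-f R) := by gcongr

end IsRadial

/-! ### Uniqueness of the ground state -/

namespace IsGroundState

variable {d a b : ℝ} {u V w W : ℝ → ℝ}

theorem isRadial_u (h : IsGroundState d a u V) (hd : 0 < d) :
    IsRadial d u (deriv u) (fun r => (V r - 1) * u r) :=
  .of_contDiffOn hd h.contDiffOn_u h.deriv_u_zero h.eq_u

theorem isRadial_V (h : IsGroundState d a u V) (hd : 0 < d) :
    IsRadial d V (deriv V) (fun r => u r ^ 2) :=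
  .of_contDiffOn hd h.contDiffOn_V h.deriv_V_zero h.eq_V

theorem pos_of_nonneg (h : IsGroundState d a u V) {r : ℝ} (hr : 0 ≤ r) : 0 < u r := by
  rcases hr.eq_or_lt with rfl | hr
  · rw [h.u_zero]
    exact h.init_pos
  · exact h.pos r hr

/-- If a < 1, then ψ = 1 - V - u starts at 1 - a > 0 and satisfies Δψ = uψ, so ψ ≥ 1 - a. Thus V - 1
≤ -(1 - a), too negative for u to stay positive. -/
theorem one_le_init (h : IsGroundState d a u V) (hd : 0 < d) : 1 ≤ a := by
  by_contra! hlt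
  have hψ := ((IsRadial.const d 1).sub (h.isRadial_V hd)).sub (h.isRadial_u hd)
  have h1 := hψ.le_of_mul_le_laplacian (c := u) (fun r hr => (h.pos r hr).le)
    (by rw [h.V_zero, h.u_zero]; linarith) (fun r _ => le_of_eq (by ring))
  rw [h.V_zero, h.u_zero] at h1
  refine (h.isRadial_u hd).not_pos_of_laplacian_le hd (k := 1 - a) (by linarith) h.pos fun r hr => ?_
  have := h.pos r hr
  refine mul_le_mul_of_nonneg_right ?_ this.le
  linarith [h1 r hr.le]

/-- Ground states starting above `1` have potential eventually above `1`, uniformly. -/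
theorem eventually_lt_potential (h : IsGroundState d a u V) (hd : 0 < d) (ha : 1 < a) :
    ∃ R, 0 < R ∧ ∀ r, R ≤ r → (a - 1) / 2 ≤ V r - 1 := by
  have hψ := (h.isRadial_u hd).sub ((IsRadial.const d 1).sub (h.isRadial_V hd))
  have h1 := hψ.le_of_mul_le_laplacian (c := u) (fun r hr => (h.pos r hr).le)
    (by rw [h.V_zero, h.u_zero]; linarith) (fun r _ => le_of_eq (by ring))
  rw [h.V_zero, h.u_zero] at h1
  have h2 := h.tendsto_zero.eventually (gt_mem_nhds (show (0 : ℝ) < (a - 1) / 2 by linarith))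
  obtain ⟨R, hR⟩ := eventually_atTop.1 h2
  refine ⟨max R 1, by positivity, fun r hr => ?_⟩
  have h3 := hR r ((le_max_left _ _).trans hr)
  have h4 := h1 r (zero_le_one.trans ((le_max_right _ _).trans hr))
  linarith

theorem potential_lt (h : IsGroundState d a u V) (k : IsGroundState d b w W) (hd : 0 < d) {R : ℝ}
    (hlt : ∀ s, 0 ≤ s → s < R → u s < w s) {r : ℝ} (hr : 0 < r) (hrR : r ≤ R) : V r < W r := by
  have h1 := ((k.isRadial_V hd).sub (h.isRadial_V hd)).strictMonoOn (R := R) (fun s hs => by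
    have h2 := hlt s hs.1.le hs.2
    have h3 := h.pos s hs.1
    exact sub_pos.2 (by gcongr)) ⟨le_rfl, hr.le.trans hrR⟩ ⟨hr.le, hrR⟩ hr
  simp only [h.V_zero, k.V_zero] at h1
  linarith

/-- Up to a first contact W > V, so w/u is nondecreasing and stays at least b/a > 1; contact is
impossible. -/
theorem lt_of_init_lt (h : IsGroundState d a u V) (k : IsGroundState d b w W) (hd : 0 < d)
    (hab : a < b) : ∀ r, 0 ≤ r → u r < w r := by
  have key := pos_of_no_first_zero (f := fun r => w r - u r)
    ((k.isRadial_u hd).continuousOn.sub (h.isRadial_u hd).continuousOn)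
    (by simp only [k.u_zero, h.u_zero]; linarith) fun r hr hs => by
      have hlt : ∀ s, 0 ≤ s → s < r → u s < w s := fun s h0 h1 => sub_pos.1 (hs s h0 h1)
      have h1 := (h.isRadial_u hd).div_monotoneOn (k.isRadial_u hd) (R := r)
        (fun s hs => h.pos_of_nonneg hs.1) (fun s hs => by
          have h2 := h.potential_lt k hd hlt hs.1 hs.2.le
          have h3 := mul_pos (h.pos s hs.1) (k.pos s hs.1)
          nlinarith) ⟨le_rfl, hr.le⟩ ⟨hr.le, le_rfl⟩ hr.le
      simp only [h.u_zero, k.u_zero] at h1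
      have h4 : 1 < b / a := (one_lt_div h.init_pos).2 hab
      exact sub_pos.2 ((one_lt_div (h.pos r hr)).1 (h4.trans_le h1))
  exact fun r hr => sub_pos.1 (key r hr)

theorem not_init_lt (h : IsGroundState d a u V) (k : IsGroundState d b w W) (hd : 0 < d) :
    ¬ a < b := by
  intro hab
  have hlt := h.lt_of_init_lt k hd hab
  have hb : 1 < b := (h.one_le_init hd).trans_lt hab
  have hu := h.isRadial_u hd
  have hw := k.isRadial_u hd
  obtain ⟨R, hR, hV⟩ := k.eventually_lt_potential hd hb
  obtain ⟨C, hC, hdecay⟩ := hw.flux_decay hd (c := (b - 1) / 2) (by linarith) hR k.pos k.deriv_neg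
    fun r hr => mul_le_mul_of_nonneg_right (hV r hr) (k.pos r (hR.trans_le hr)).le
  have hWr : ∀ R, ∀ r ∈ Ioo 0 R, w r * ((V r - 1) * u r) < (W r - 1) * w r * u r := by
    intro R r hr
    have h2 := h.potential_lt k hd (R := R) (fun s h0 _ => hlt s h0) hr.1 hr.2.le
    have h3 := mul_pos (h.pos r hr.1) (k.pos r hr.1)
    nlinarith
  set Q : ℝ → ℝ := fun s => s ^ (d - 1) * deriv w s * u s - w s * (s ^ (d - 1) * deriv u s)
  have hm : 0 < Q 1 := hu.wronskian_pos hw one_pos (hWr 1)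
  have hQ : ∀ r, 1 ≤ r → Q 1 ≤ Q r := fun r hr =>
    hu.wronskian_monotoneOn hw (R := r) (fun s hs => (hWr r s hs).le) ⟨one_pos, hr⟩
      ⟨one_pos.trans_le hr, le_rfl⟩ hr
  -- In Q the term with w' is nonpositive, so Q(1) ≤ Q(r) ≤ r^(d-1) w (-u') ≤ C (-u').
  have hderiv : ∀ r, R + 2 ≤ r → deriv u r ≤ -(Q 1 / C) := by
    intro r hr
    have hr0 : 0 < r := by linarith
    have h1 : Q r ≤ r ^ (d - 1) * w r * (-deriv u r) := by
      have h2 : 0 < r ^ (d - 1) := Real.rpow_pos_of_pos hr0 _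
      have h3 : r ^ (d - 1) * deriv w r * u r ≤ 0 :=
        mul_nonpos_of_nonpos_of_nonneg
          (mul_nonpos_of_nonneg_of_nonpos h2.le (k.deriv_neg r hr0).le) (h.pos r hr0).le
      simp only [Q]
      linarith
    have h4 : r ^ (d - 1) * w r * (-deriv u r) ≤ C * (-deriv u r) :=
      mul_le_mul_of_nonneg_right (hdecay r hr) (by linarith [h.deriv_neg r hr0])
    have h5 : Q 1 / C ≤ -deriv u r := by
      rw [div_le_iff₀' hC]
      linarith [hQ r (by linarith)]
    linarith
  set c := Q 1 / C
  have hc : 0 < c := by positivity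
  have hlin : ∀ r, R + 2 ≤ r → u r ≤ u (R + 2) - c * (r - (R + 2)) := by
    intro r hr
    have hD : ∀ s, 0 < s → HasDerivAt (fun s => u s + c * s) (deriv u s + c * 1) s := fun s hs =>
      (hu.hasDerivAt s hs).add ((hasDerivAt_id s).const_mul c)
    have := (antitoneOn_of_hasDerivWithinAt_nonpos (convex_Ici (R + 2))
      (fun s hs => (hD s (lt_of_lt_of_le (by linarith) hs)).continuousAt.continuousWithinAt)
      (fun s hs => (hD s ?_).hasDerivWithinAt) (fun s hs => ?_)) self_mem_Ici hr hr
    · simp only at this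
      linarith
    · rw [interior_Ici] at hs
      exact lt_trans (by linarith) hs
    · rw [interior_Ici] at hs
      linarith [hderiv s (le_of_lt hs)]
  have hu2 : 0 < u (R + 2) := h.pos _ (by linarith)
  -- The point where the linear upper bound for u reaches 0.
  have h1 := hlin (R + 2 + u (R + 2) / c) (by linarith [div_pos hu2 hc])
  have h2 := h.pos (R + 2 + u (R + 2) / c) (by linarith [div_pos hu2 hc])
  rw [add_sub_cancel_left, mul_div_cancel₀ _ hc.ne'] at h1
  linarith

theorem eq_of_init_eq (h : IsGroundState d a u V) (k : IsGroundState d a w W) (hd : 0 < d) {R : ℝ}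
    (hR : 0 < R) : ∀ r ∈ Icc 0 R, u r - w r = 0 ∧ V r - W r = 0 := by
  have hu := h.isRadial_u hd
  have hw := k.isRadial_u hd
  have hV := h.isRadial_V hd
  have hW := k.isRadial_V hd
  have hsub : Icc 0 R ⊆ Ici 0 := Icc_subset_Ici_self
  obtain ⟨L, hL⟩ := isCompact_Icc.exists_bound_of_continuousOn
    (f := fun r => |V r - 1| + |u r| + |w r|) (s := Icc 0 R)
    ((((hV.continuousOn.mono hsub).sub continuousOn_const).abs.add
      (hu.continuousOn.mono hsub).abs).add (hw.continuousOn.mono hsub).abs)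
  have hL' : ∀ r ∈ Icc 0 R, |V r - 1| + |u r| + |w r| ≤ |L| + 1 := fun r hr => by
    have := (le_abs_self _).trans (hL r hr)
    linarith [le_abs_self L]
  refine (hu.sub hw).eq_zero_of_abs_laplacian_le hd (hV.sub hW) (L := |L| + 1)
    (by rw [h.u_zero, k.u_zero, sub_self]) (by rw [h.V_zero, k.V_zero, sub_self])
    (by positivity) hR (fun r hr => ?_) (fun r hr => ?_)
  all_goals
    have hb := hL' r (Ioo_subset_Icc_self hr)
    have h1 := abs_nonneg (V r - 1)
    have h2 := abs_nonneg (u r)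
    have h3 := abs_nonneg (w r)
  · rw [show (V r - 1) * u r - (W r - 1) * w r = (V r - 1) * (u r - w r) + w r * (V r - W r) by
      ring, mul_add]
    refine (abs_add_le _ _).trans ?_
    rw [abs_mul, abs_mul]
    gcongr <;> linarith
  · rw [show u r ^ 2 - w r ^ 2 = (u r + w r) * (u r - w r) by ring, abs_mul]
    have h4 := abs_add_le (u r) (w r)
    gcongr
    · linarith
    · linarith [abs_nonneg (V r - W r)]

theorem unique (h : IsGroundState d a u V) (k : IsGroundState d b w W) (hd : 0 < d) :
    b = a ∧ EqOn w u (Ici 0) ∧ EqOn W V (Ici 0) := by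
  have hab : b = a := le_antisymm (not_lt.1 (h.not_init_lt k hd)) (not_lt.1 (k.not_init_lt h hd))
  subst hab
  have key : ∀ r, 0 ≤ r → u r - w r = 0 ∧ V r - W r = 0 := fun r hr =>
    h.eq_of_init_eq k hd (R := r + 1) (by linarith) r ⟨hr, by linarith⟩
  exact ⟨rfl, fun r hr => (sub_eq_zero.1 (key r hr).1).symm,
    fun r hr => (sub_eq_zero.1 (key r hr).2).symm⟩

end IsGroundState

/-! ### Backward uniqueness and the truncated system -/

namespace IsRadial

variable {d : ℝ} {u u' g : ℝ → ℝ}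

/-- For C large the energy (u^2 + u'^2) exp(C r) is nondecreasing on [ρ, R]. It vanishes at R, hence
also at ρ. -/
theorem eq_zero_of_cauchy_data (hu : IsRadial d u u' g) {ρ R M : ℝ} (hM : 0 ≤ M) (hρ : 0 < ρ) (hρR : ρ ≤ R)
    (hg : ∀ r ∈ Icc ρ R, |g r| ≤ M * |u r|) (h0 : u R = 0) (h1 : u' R = 0) : u ρ = 0 := by
  set C : ℝ := 1 + M + 2 * (|d - 1| / ρ)
  set D : ℝ → ℝ := fun r => 2 * u r * u' r + 2 * u' r * (g r - (d - 1) / r * u' r)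
  have hD : ∀ r, 0 < r → HasDerivAt (fun r => (u r ^ 2 + u' r ^ 2) * Real.exp (C * r))
      (D r * Real.exp (C * r) + (u r ^ 2 + u' r ^ 2) * (Real.exp (C * r) * (C * 1))) r :=
    fun r hr => ((((hu.hasDerivAt r hr).pow 2).add ((hu.hasDerivAt' r hr).pow 2)).mul
      ((hasDerivAt_id r).const_mul C).exp).congr_deriv (by simp [D])
  have hmono := monotoneOn_of_hasDerivWithinAt_nonneg (convex_Icc ρ R)
    (fun r hr => (hD r (hρ.trans_le hr.1)).continuousAt.continuousWithinAt)
    (fun r hr => by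
      rw [interior_Icc] at hr
      exact (hD r (hρ.trans hr.1)).hasDerivWithinAt)
    (fun r hr => by
      rw [interior_Icc] at hr
      have hr0 := hρ.trans hr.1
      have e1 : -(u r ^ 2 + u' r ^ 2) ≤ 2 * u r * u' r := by nlinarith [sq_nonneg (u r + u' r)]
      have e2 : -(M * (u r ^ 2 + u' r ^ 2)) ≤ 2 * u' r * g r := by
        have hgr := hg r (Ioo_subset_Icc_self hr)
        have a1 : |2 * u' r * g r| ≤ 2 * |u' r| * (M * |u r|) := by
          rw [abs_mul, abs_mul, abs_two]
          gcongr
        have a2 : 2 * |u' r| * (M * |u r|) ≤ M * (u r ^ 2 + u' r ^ 2) := by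
          rw [← sq_abs (u r), ← sq_abs (u' r)]
          nlinarith [mul_nonneg hM (sq_nonneg (|u r| - |u' r|))]
        linarith [neg_abs_le (2 * u' r * g r)]
      have e3 : -(2 * (|d - 1| / ρ) * (u r ^ 2 + u' r ^ 2)) ≤
          -(2 * ((d - 1) / r) * u' r ^ 2) := by
        have b1 : (d - 1) / r ≤ |d - 1| / ρ := by
          refine (div_le_div_of_nonneg_right (le_abs_self _) hr0.le).trans ?_
          gcongr
          exact hr.1.le
        have b2 : 0 ≤ |d - 1| / ρ := by positivity
        nlinarith [sq_nonneg (u r), sq_nonneg (u' r),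
          mul_le_mul_of_nonneg_right b1 (sq_nonneg (u' r)), mul_nonneg b2 (sq_nonneg (u r))]
      have e4 : 0 ≤ D r + C * (u r ^ 2 + u' r ^ 2) := by
        simp only [D, C]
        nlinarith
      have e5 := mul_nonneg e4 (Real.exp_pos (C * r)).le
      nlinarith) ⟨le_rfl, hρR⟩ ⟨hρR, le_rfl⟩ hρR
  simp only [h0, h1] at hmono
  have e6 : (u ρ ^ 2 + u' ρ ^ 2) * Real.exp (C * ρ) ≤ 0 := by simpa using hmono
  have e7 := nonpos_of_mul_nonpos_left e6 (Real.exp_pos _)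
  nlinarith [sq_nonneg (u ρ), sq_nonneg (u' ρ)]

theorem le_of_quadratic_le_laplacian (hu : IsRadial d u u' g) (hd : 0 < d) {R α β : ℝ} (hR : 0 ≤ R)
    (hg : ∀ r ∈ Ioo 0 R, α * r ^ 2 - β ≤ g r) :
    u 0 + α * (R ^ 4 / (4 * (d + 2))) - β * (R ^ 2 / (2 * d)) ≤ u R := by
  have := ((hu.sub ((pow_four hd).const_mul α)).add ((sq hd).const_mul β)).le_of_laplacian_nonneg
    hR fun r hr => by linarith [hg r hr]
  simp at this
  linarith

end IsRadial

theorem HasDerivAt.exists_lt_left {f : ℝ → ℝ} {m r : ℝ} (h : HasDerivAt f m r) (hm : 0 < m)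
    (hr : 0 < r) : ∃ s, 0 ≤ s ∧ s < r ∧ f s < f r := by
  have h1 := (hasDerivAt_iff_tendsto_slope.1 h).mono_left
    (nhdsWithin_mono r (s := Iio r) fun s hs => ne_of_lt hs)
  obtain ⟨s, hs, h0⟩ := ((h1.eventually (lt_mem_nhds hm)).and (Ioo_mem_nhdsLT hr)).exists
  refine ⟨s, h0.1.le, h0.2, ?_⟩
  rw [slope_def_field] at hs
  have h2 : s - r < 0 := by linarith [h0.2]
  by_contra! hle
  exact absurd hs (not_lt.2 (div_nonpos_of_nonneg_of_nonpos (by linarith) h2.le))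

/-- The truncation of `x` to the interval `[0, K]`. -/
noncomputable def clip (K x : ℝ) : ℝ := max 0 (min x K)

section Clip

variable {K x y : ℝ}

theorem clip_nonneg : 0 ≤ clip K x := le_max_left _ _

theorem clip_le (hK : 0 ≤ K) : clip K x ≤ K := max_le hK (min_le_right _ _)

theorem clip_eq (h0 : 0 ≤ x) (hK : x ≤ K) : clip K x = x := by
  rw [clip, min_eq_left hK, max_eq_right h0]

theorem clip_le_self (h0 : 0 ≤ x) : clip K x ≤ x := max_le h0 (min_le_left _ _)

theorem le_clip (h : y ≤ x) (hK : y ≤ K) : y ≤ clip K x := (le_min h hK).trans (le_max_right _ _)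

theorem abs_clip_le : |clip K x| ≤ |x| := by
  rw [abs_of_nonneg clip_nonneg]
  exact max_le (abs_nonneg x) ((min_le_left _ _).trans (le_abs_self x))

theorem abs_clip_sub_clip_le : |clip K x - clip K y| ≤ |x - y| := by
  simp only [clip]
  grind

theorem continuous_clip : Continuous fun p : ℝ × ℝ => clip p.1 p.2 := by
  unfold clip
  fun_prop

end Clip

/-- A solution of the Schrödinger-Newton system in which `u` is truncated to `[0, K]` on the
right-hand sides. -/
structure IsTruncatedSolution (d K a : ℝ) (u V : ℝ → ℝ) : Prop where
  contDiff_u : ContDiff ℝ 2 u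
  contDiff_V : ContDiff ℝ 2 V
  eq_u : ∀ r : ℝ, 0 < r → radialLaplacian d u r = (V r - 1) * clip K (u r)
  eq_V : ∀ r : ℝ, 0 < r → radialLaplacian d V r = clip K (u r) ^ 2
  u_zero : u 0 = a
  deriv_u_zero : deriv u 0 = 0
  V_zero : V 0 = 0
  deriv_V_zero : deriv V 0 = 0

theorem IsRadial.of_contDiff {d : ℝ} {u g : ℝ → ℝ} (hd : 0 < d) (hu : ContDiff ℝ 2 u)
    (h0 : deriv u 0 = 0) (h : ∀ r, 0 < r → radialLaplacian d u r = g r) :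
    IsRadial d u (deriv u) g :=
  .of_contDiffOn hd hu.contDiffOn (by
    rw [(hu.differentiable (by norm_num) 0).derivWithin (uniqueDiffOn_Ici 0 0 self_mem_Ici), h0]) h

/-- To make the product (V - 1)u Lipschitz, V is truncated too, at K^2 t^2/(2d). Since 0 ≤ ΔV ≤ K^2,
the solution obeys this bound by itself, so the truncation of V is never active. -/
theorem exists_truncated_flow {d K : ℝ} (hd : 0 < d) (hK : 0 ≤ K) :
    ∃ u V : ℝ → ℝ → ℝ, (∀ a, IsTruncatedSolution d K a (u a) (V a)) ∧
      ∀ R, ∃ L, ∀ a b, ∀ r ∈ Icc 0 R, |u a r - u b r| ≤ L * |a - b| := by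
  set F : ℝ → ℝ × ℝ → ℝ × ℝ := fun t p =>
    ((clip (K ^ 2 * (t ^ 2 / (2 * d))) p.2 - 1) * clip K p.1, clip K p.1 ^ 2)
  have hF : Continuous (Function.uncurry F) := by
    have h1 : Continuous fun q : ℝ × ℝ × ℝ => clip (K ^ 2 * (q.1 ^ 2 / (2 * d))) q.2.2 :=
      continuous_clip.comp (by fun_prop : Continuous fun q : ℝ × ℝ × ℝ =>
        (K ^ 2 * (q.1 ^ 2 / (2 * d)), q.2.2))
    have h2 : Continuous fun q : ℝ × ℝ × ℝ => clip K q.2.1 :=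
      continuous_clip.comp (by fun_prop : Continuous fun q : ℝ × ℝ × ℝ => (K, q.2.1))
    exact ((h1.sub continuous_const).mul h2).prodMk (h2.pow 2)
  have hF0 : ∀ t, F t 0 = 0 := fun t => by
    simp [F, clip_eq le_rfl hK]
  have hL : ∀ t x y, ‖F t x - F t y‖ ≤ (K ^ 2 / (2 * d) + 1 + 2 * K) * (1 + t ^ 2) * ‖x - y‖ := by
    intro t x y
    have n1 : |x.1 - y.1| ≤ ‖x - y‖ := norm_fst_le (x - y)
    have n2 : |x.2 - y.2| ≤ ‖x - y‖ := norm_snd_le (x - y)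
    have hN := norm_nonneg (x - y)
    set m := K ^ 2 * (t ^ 2 / (2 * d))
    have hm : 0 ≤ m := by positivity
    have hcoef : m + 1 + 2 * K ≤ (K ^ 2 / (2 * d) + 1 + 2 * K) * (1 + t ^ 2) := by
      have : m = K ^ 2 / (2 * d) * t ^ 2 := by simp only [m]; ring
      have h3 : 0 ≤ K ^ 2 / (2 * d) := by positivity
      rw [this]
      nlinarith [sq_nonneg t, mul_nonneg hK (sq_nonneg t)]
    have c1 : |clip K x.1 - clip K y.1| ≤ ‖x - y‖ := abs_clip_sub_clip_le.trans n1
    have c2 : |clip m x.2 - clip m y.2| ≤ ‖x - y‖ := abs_clip_sub_clip_le.trans n2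
    have c3 : |clip m x.2 - 1| ≤ m + 1 := by
      have := clip_nonneg (K := m) (x := x.2)
      have := clip_le (x := x.2) hm
      rw [abs_le]
      constructor <;> linarith
    have c4 : |clip K y.1| ≤ K := by
      rw [abs_of_nonneg clip_nonneg]
      exact clip_le hK
    have c5 : |clip K x.1 + clip K y.1| ≤ 2 * K := by
      rw [abs_of_nonneg (add_nonneg clip_nonneg clip_nonneg)]
      linarith [clip_le (x := x.1) hK, clip_le (x := y.1) hK]
    refine le_trans ?_ (mul_le_mul_of_nonneg_right hcoef hN)
    refine max_le ?_ ?_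
    · change |(clip m x.2 - 1) * clip K x.1 - (clip m y.2 - 1) * clip K y.1| ≤ _
      rw [show (clip m x.2 - 1) * clip K x.1 - (clip m y.2 - 1) * clip K y.1 =
        (clip m x.2 - 1) * (clip K x.1 - clip K y.1) +
          (clip m x.2 - clip m y.2) * clip K y.1 by ring]
      refine (abs_add_le _ _).trans ?_
      rw [abs_mul, abs_mul]
      have := mul_le_mul c3 c1 (abs_nonneg _) (by linarith)
      have := mul_le_mul c2 c4 (abs_nonneg _) hN
      nlinarith
    · change |clip K x.1 ^ 2 - clip K y.1 ^ 2| ≤ _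
      rw [sq_sub_sq, abs_mul]
      have := mul_le_mul c5 c1 (abs_nonneg _) (by linarith)
      nlinarith
  obtain ⟨Y, hY, hdep⟩ := exists_radial_flow hd hF hF0 (by positivity) hL
  refine ⟨fun a r => (Y (a, 0) r).1, fun a r => (Y (a, 0) r).2, fun a => ?_, fun R => ?_⟩
  · obtain ⟨hC, h0, h1, hE⟩ := hY (a, 0)
    set y := Y (a, 0)
    have hy : ∀ r, HasDerivAt y (deriv y r) r := fun r =>
      (hC.differentiable (by norm_num) r).hasDerivAt
    have hy2 : ∀ r, HasDerivAt (deriv y) (deriv (deriv y) r) r := fun r => by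
      have hC1 : ContDiff ℝ 1 (deriv y) :=
        (contDiff_succ_iff_deriv.1 (show ContDiff ℝ (1 + 1) y by norm_num; exact hC)).2.2
      exact (hC1.differentiable (by norm_num) r).hasDerivAt
    have d1 : deriv (fun r => (y r).1) = fun r => (deriv y r).1 := funext fun r =>
      ((ContinuousLinearMap.fst ℝ ℝ ℝ).hasFDerivAt.comp_hasDerivAt r (hy r)).deriv
    have d2 : deriv (fun r => (y r).2) = fun r => (deriv y r).2 := funext fun r =>
      ((ContinuousLinearMap.snd ℝ ℝ ℝ).hasFDerivAt.comp_hasDerivAt r (hy r)).deriv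
    have dd1 : ∀ r, deriv (fun r => (deriv y r).1) r = (deriv (deriv y) r).1 := fun r =>
      ((ContinuousLinearMap.fst ℝ ℝ ℝ).hasFDerivAt.comp_hasDerivAt r (hy2 r)).deriv
    have dd2 : ∀ r, deriv (fun r => (deriv y r).2) r = (deriv (deriv y) r).2 := fun r =>
      ((ContinuousLinearMap.snd ℝ ℝ ℝ).hasFDerivAt.comp_hasDerivAt r (hy2 r)).deriv
    have eV : ∀ r : ℝ, 0 < r → radialLaplacian d (fun r => (y r).2) r = clip K (y r).1 ^ 2 :=
      fun r hr => by
        rw [radialLaplacian, d2, dd2]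
        exact congrArg Prod.snd (hE r hr)
    have hVr := IsRadial.of_contDiff hd (contDiff_snd.comp hC) (by
      change deriv (fun r => (y r).2) 0 = 0
      rw [d2]
      simp [h1]) eV
    refine ⟨contDiff_fst.comp hC, contDiff_snd.comp hC, fun r hr => ?_, eV, ?_, ?_, ?_, ?_⟩
    · have e1 := congrArg Prod.fst (hE r hr)
      have b1 := hVr.le_of_le_laplacian hd (c := 0) hr.le fun s _ => sq_nonneg _
      have b2 := hVr.le_of_laplacian_le hd (c := K ^ 2) hr.le fun s _ => by
        have := clip_le (x := (y s).1) hK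
        have := clip_nonneg (K := K) (x := (y s).1)
        gcongr
      simp only [Function.comp, h0] at b1 b2
      rw [radialLaplacian, d1, dd1]
      refine e1.trans ?_
      simp only [F]
      rw [clip_eq (by linarith) (by linarith)]
    · exact congrArg Prod.fst h0
    · exact (congrFun d1 0).trans (congrArg Prod.fst h1)
    · exact congrArg Prod.snd h0
    · exact (congrFun d2 0).trans (congrArg Prod.snd h1)
  · obtain ⟨L, hL⟩ := hdep R
    refine ⟨L, fun a b r hr => ?_⟩
    have h1 := (norm_fst_le _).trans (hL (a, 0) (b, 0) r hr)
    have h2 : ‖((a, 0) : ℝ × ℝ) - (b, 0)‖ = |a - b| := by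
      simp [Prod.norm_def]
    rwa [h2] at h1

/-! ### The shooting argument -/

namespace IsTruncatedSolution

variable {d K a : ℝ} {u V : ℝ → ℝ}

theorem isRadial_u (h : IsTruncatedSolution d K a u V) (hd : 0 < d) :
    IsRadial d u (deriv u) (fun r => (V r - 1) * clip K (u r)) :=
  .of_contDiff hd h.contDiff_u h.deriv_u_zero h.eq_u

theorem isRadial_V (h : IsTruncatedSolution d K a u V) (hd : 0 < d) :
    IsRadial d V (deriv V) (fun r => clip K (u r) ^ 2) :=
  .of_contDiff hd h.contDiff_V h.deriv_V_zero h.eq_V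

theorem V_mono (h : IsTruncatedSolution d K a u V) (hd : 0 < d) {s r : ℝ} (hs : 0 ≤ s)
    (hsr : s ≤ r) : V s ≤ V r :=
  (h.isRadial_V hd).monotoneOn (R := r) (fun _ _ => sq_nonneg _) ⟨hs, hsr⟩ ⟨hs.trans hsr, le_rfl⟩ hsr

theorem V_nonneg (h : IsTruncatedSolution d K a u V) (hd : 0 < d) {r : ℝ} (hr : 0 ≤ r) :
    0 ≤ V r :=
  h.V_zero ▸ h.V_mono hd le_rfl hr

/-- A zero of a nonnegative u is a minimum, so u' vanishes there as well. Backward uniqueness then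
makes u vanish up to the origin, against u(0) = a > 0. -/
theorem pos_of_nonneg (h : IsTruncatedSolution d K a u V) (hd : 0 < d) (ha : 0 < a)
    (hu : ∀ r, 0 < r → 0 ≤ u r) : ∀ r, 0 ≤ r → 0 < u r := by
  intro R hR
  rcases hR.eq_or_lt with rfl | hR
  · rwa [h.u_zero]
  refine lt_of_le_of_ne (hu R hR) fun heq => ?_
  have hmin : IsLocalMin u R := by
    filter_upwards [Ioi_mem_nhds hR] with s hs
    rw [← heq]
    exact hu s hs
  have hder := hmin.deriv_eq_zero
  have hzero : ∀ r ∈ Ioo 0 R, u r = 0 := fun ρ hρ =>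
    (h.isRadial_u hd).eq_zero_of_cauchy_data (M := V R + 1) (by linarith [h.V_nonneg hd hR.le]) hρ.1 hρ.2.le (fun r hr => by
      have h0 := hρ.1.le.trans hr.1
      have h1 := h.V_mono hd h0 hr.2
      have h2 := h.V_nonneg hd h0
      rw [abs_mul]
      refine mul_le_mul ?_ abs_clip_le (abs_nonneg _) (by linarith)
      rw [abs_le]
      constructor <;> linarith) heq.symm hder
  have hcont := ((h.contDiff_u.continuous.tendsto 0).mono_left (nhdsWithin_le_nhds (s := Ioi 0)))
  rw [h.u_zero] at hcont
  obtain ⟨s, hs1, hs2⟩ := ((hcont.eventually (lt_mem_nhds ha)).and (Ioo_mem_nhdsGT hR)).exists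
  exact hs1.ne' (hzero s hs2)

theorem exists_neg_of_init_lt_one (h : IsTruncatedSolution d K a u V) (hd : 0 < d) (ha : 0 < a)
    (ha1 : a < 1) (hK : 1 ≤ K) : ∃ r, 0 < r ∧ u r < 0 := by
  by_contra! hnn
  have hu := h.isRadial_u hd
  have hpos := h.pos_of_nonneg hd ha hnn
  have hψ := ((IsRadial.const d 1).sub (h.isRadial_V hd)).sub hu
  have h1 := hψ.le_of_mul_le_laplacian (c := fun r => clip K (u r)) (fun r _ => clip_nonneg)
    (by rw [h.V_zero, h.u_zero]; linarith) (fun r hr => by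
      have h2 := clip_le_self (K := K) (hpos r hr.le).le
      have h3 := clip_nonneg (K := K) (x := u r)
      nlinarith)
  rw [h.V_zero, h.u_zero] at h1
  have hV : ∀ r, 0 ≤ r → V r - 1 ≤ -(1 - a) := fun r hr => by linarith [h1 r hr, hpos r hr]
  have hle : ∀ r, 0 ≤ r → u r ≤ K := fun r hr => by
    have := hu.le_of_laplacian_le hd (c := 0) hr fun s hs =>
      mul_nonpos_of_nonpos_of_nonneg (by linarith [hV s hs.1.le]) clip_nonneg
    rw [h.u_zero] at this
    linarith
  refine hu.not_pos_of_laplacian_le hd (k := 1 - a) (by linarith) (fun r hr => hpos r hr.le)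
    fun r hr => ?_
  rw [clip_eq (hpos r hr.le).le (hle r hr.le)]
  exact mul_le_mul_of_nonneg_right (hV r hr.le) (hpos r hr.le).le

/-- Where u' > 0 one must have V > 1, since V is monotone and V ≤ 1 up to that point would make the
flux nonpositive. From there on V stays above 1, the flux cannot decrease, and u never falls again.
-/
theorem pos_of_increase (h : IsTruncatedSolution d K a u V) (hd : 0 < d) {s r : ℝ} (hs : 0 ≤ s)
    (hsr : s < r) (hlt : u s < u r) (hpos : ∀ x ∈ Icc 0 r, 0 < u x) : ∀ x, 0 ≤ x → 0 < u x := by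
  have hu := h.isRadial_u hd
  obtain ⟨x, hx, hxe⟩ := exists_hasDerivAt_eq_slope u (deriv u) hsr
    h.contDiff_u.continuous.continuousOn (fun y hy => hu.hasDerivAt y (hs.trans_lt hy.1))
  have hx0 : 0 < x := hs.trans_lt hx.1
  have hx' : 0 < deriv u x := by
    rw [hxe]
    exact div_pos (by linarith) (by linarith)
  have hVx : 1 < V x := by
    by_contra! hle
    have := (hu.const_mul (-1)).deriv_nonneg hx0 fun y hy => by
      have h1 := h.V_mono hd hy.1.le hy.2.le
      have h2 := clip_nonneg (K := K) (x := u y)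
      nlinarith
    linarith
  intro y hy
  rcases le_or_gt y x with hyx | hyx
  · exact hpos y ⟨hy, hyx.trans hx.2.le⟩
  have hmono := hu.monotoneOn_of_deriv_nonneg (a := x) (R := y) hx0.le (fun z hz => by
    have h1 := hu.flux_monotoneOn_Icc hx0 (R := z) (fun t ht => by
      have h2 := h.V_mono hd hx0.le ht.1.le
      have h3 := clip_nonneg (K := K) (x := u t)
      exact mul_nonneg (by linarith) h3) ⟨le_rfl, hz.1.le⟩ ⟨hz.1.le, le_rfl⟩ hz.1.le
    have h4 : 0 ≤ z ^ (d - 1) * deriv u z := le_trans (by positivity) h1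
    exact nonneg_of_mul_nonneg_right h4 (Real.rpow_pos_of_pos (hx0.trans hz.1) _))
  exact (hpos x ⟨hx0.le, hx.2.le⟩).trans_le (hmono ⟨le_rfl, hyx.le⟩ ⟨hyx.le, le_rfl⟩ hyx.le)

/-- On [0, √d] the bound Δu ≥ -K costs at most K/2, so u ≥ K/2 and V ≥ K^2 r^2/(8d). The resulting
quartic gain K^3 d/(64(d+2)) at √d beats the loss K/2 exactly under the condition on K. -/
theorem exists_increase (h : IsTruncatedSolution d K K u V) (hd : 0 < d) (hK : 0 < K)
    (hKd : 32 * (d + 2) / d < K ^ 2) :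
    ∃ s r, 0 ≤ s ∧ s < r ∧ u s < u r ∧ ∀ x ∈ Icc 0 r, 0 < u x := by
  have hu := h.isRadial_u hd
  have hlow : ∀ x ∈ Icc 0 (√d), K / 2 ≤ u x := fun x hx => by
    have h1 := hu.le_of_le_laplacian hd (c := -K) hx.1 fun s hs => by
      have h2 := h.V_nonneg hd hs.1.le
      have h3 := clip_nonneg (K := K) (x := u s)
      have h4 := clip_le (x := u s) hK.le
      nlinarith
    have h5 : x ^ 2 / (2 * d) ≤ 1 / 2 := by
      rw [div_le_div_iff₀ (by positivity) (by norm_num)]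
      have := (Real.le_sqrt hx.1 hd.le).1 hx.2
      linarith
    rw [h.u_zero] at h1
    nlinarith
  refine ⟨0, √d, le_rfl, Real.sqrt_pos.2 hd, ?_, fun x hx => (by positivity : 0 < K / 2).trans_le
    (hlow x hx)⟩
  have hclip : ∀ x ∈ Icc 0 (√d), K / 2 ≤ clip K (u x) := fun x hx =>
    le_clip (hlow x hx) (by linarith)
  have h1 := hu.le_of_quadratic_le_laplacian hd (Real.sqrt_nonneg d)
    (α := K / 2 * (K ^ 2 / 4 / (2 * d))) (β := K) fun r hr => by
      have h2 := (h.isRadial_V hd).le_of_le_laplacian hd (c := K ^ 2 / 4) hr.1.le fun s hs => by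
        have := hclip s ⟨hs.1.le, (hs.2.trans hr.2).le⟩
        nlinarith
      rw [h.V_zero, zero_add] at h2
      have h3 := hclip r (Ioo_subset_Icc_self hr)
      have h4 := clip_le (x := u r) hK.le
      have h5 := h.V_nonneg hd hr.1.le
      calc K / 2 * (K ^ 2 / 4 / (2 * d)) * r ^ 2 - K
          = K ^ 2 / 4 * (r ^ 2 / (2 * d)) * (K / 2) - K := by ring
        _ ≤ V r * clip K (u r) - clip K (u r) := by gcongr
        _ = (V r - 1) * clip K (u r) := by ring
  refine lt_of_lt_of_le ?_ h1
  rw [show √d ^ 4 = (√d ^ 2) ^ 2 by ring, Real.sq_sqrt hd.le]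
  have h2 : K / 2 * (K ^ 2 / 4 / (2 * d)) * (d ^ 2 / (4 * (d + 2))) - K * (d / (2 * d)) =
      K * (K ^ 2 * d - 32 * (d + 2)) / (64 * (d + 2)) := by
    field_simp
    ring
  have h3 : 0 < K ^ 2 * d - 32 * (d + 2) := by
    rw [div_lt_iff₀ hd] at hKd
    linarith
  have h4 : 0 < K * (K ^ 2 * d - 32 * (d + 2)) / (64 * (d + 2)) := by positivity
  linarith

theorem isGroundState (h : IsTruncatedSolution d K a u V) (hd : 0 < d) (ha : 0 < a) (haK : a ≤ K)
    (hnn : ∀ r, 0 < r → 0 ≤ u r)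
    (hmono : ∀ s r, 0 ≤ s → s < r → (∀ x ∈ Icc 0 r, 0 < u x) → u r ≤ u s) :
    IsGroundState d a u V := by
  have hpos := h.pos_of_nonneg hd ha hnn
  have hanti : ∀ s r, 0 ≤ s → s ≤ r → u r ≤ u s := fun s r hs hsr => by
    rcases hsr.eq_or_lt with rfl | hsr
    · exact le_rfl
    · exact hmono s r hs hsr fun x hx => hpos x hx.1
  have hle : ∀ r, 0 ≤ r → u r ≤ a := fun r hr => h.u_zero ▸ hanti 0 r le_rfl hr
  have hclip : ∀ r, 0 ≤ r → clip K (u r) = u r := fun r hr =>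
    clip_eq (hpos r hr).le ((hle r hr).trans haK)
  have hu := (h.isRadial_u hd).congr_laplacian (h := fun r => (V r - 1) * u r)
    fun r hr => by rw [hclip r hr.le]
  have hV := (h.isRadial_V hd).congr_laplacian (h := fun r => u r ^ 2)
    fun r hr => by rw [hclip r hr.le]
  have hder : ∀ r, 0 < r → deriv u r ≤ 0 := fun r hr => by
    by_contra! hlt
    obtain ⟨s, hs, hsr, h1⟩ := (hu.hasDerivAt r hr).exists_lt_left hlt hr
    exact absurd (hanti s r hs hsr.le) (not_le.2 h1)
  have hu0 : derivWithin u (Ici 0) 0 = 0 := by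
    rw [(h.contDiff_u.differentiable (by norm_num) 0).derivWithin
      (uniqueDiffOn_Ici 0 0 self_mem_Ici), h.deriv_u_zero]
  have hV0 : derivWithin V (Ici 0) 0 = 0 := by
    rw [(h.contDiff_V.differentiable (by norm_num) 0).derivWithin
      (uniqueDiffOn_Ici 0 0 self_mem_Ici), h.deriv_V_zero]
  refine ⟨⟨h.contDiff_u.contDiffOn, h.contDiff_V.contDiffOn, fun r hr => ?_, fun r hr => ?_,
    h.u_zero, hu0, h.V_zero, hV0⟩, ha, fun r hr => hpos r hr.le, fun r hr => ?_, ?_⟩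
  · rw [h.eq_u r hr, hclip r hr.le]
  · rw [h.eq_V r hr, hclip r hr.le]
  -- If u'(r) = 0 and V(r) ≤ 1, then Δu < 0 on (0, r) forces u'(r) < 0. If V(r) > 1, the flux
  -- increases strictly after r and makes u'(r+1) positive.
  · refine lt_of_le_of_ne (hder r hr) fun heq => ?_
    rcases le_or_gt (V r) 1 with hVr | hVr
    · have := (hu.const_mul (-1)).deriv_pos hr fun s hs => by
        have h1 := hV.strictMonoOn (R := r) (fun x hx => pow_pos (hpos x hx.1.le) 2)
          (Ioo_subset_Icc_self hs) ⟨hr.le, le_rfl⟩ hs.2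
        have h2 := mul_pos (sub_pos.2 (h1.trans_le hVr)) (hpos s hs.1.le)
        linarith
      rw [heq] at this
      linarith
    · have h1 := hu.flux_strictMonoOn hr (R := r + 1) (fun s hs =>
        mul_pos (by linarith [h.V_mono hd hr.le hs.1.le]) (hpos s (hr.trans hs.1).le))
        ⟨le_rfl, by linarith⟩ ⟨by linarith, le_rfl⟩ (by linarith)
      simp only [heq, mul_zero] at h1
      have h2 := pos_of_mul_pos_right h1 (by positivity)
      linarith [hder (r + 1) (by linarith)]
  · have key : ∀ ε, 0 < ε → ∃ R, 0 ≤ R ∧ u R < ε := by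
      intro ε hε
      by_contra! hlow
      -- If u ≥ ε throughout, V grows quadratically and so u would grow like R^4, against u ≤ a.
      have hbound : ∀ R : ℝ, 0 ≤ R → ε * (ε ^ 2 / (2 * d)) * (R ^ 4 / (4 * (d + 2))) ≤
          a * (R ^ 2 / (2 * d)) := by
        intro R hR
        have h1 := hu.le_of_quadratic_le_laplacian hd hR (α := ε * (ε ^ 2 / (2 * d))) (β := a)
          fun r hr => by
            have h2 := hV.le_of_le_laplacian hd (c := ε ^ 2) hr.1.le fun s hs => by
              have := hlow s hs.1.le
              gcongr
            rw [h.V_zero, zero_add] at h2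
            have h3 := h.V_nonneg hd hr.1.le
            calc ε * (ε ^ 2 / (2 * d)) * r ^ 2 - a = ε ^ 2 * (r ^ 2 / (2 * d)) * ε - a := by ring
              _ ≤ V r * u r - u r := by
                have := hlow r hr.1.le
                have := hle r hr.1.le
                gcongr
              _ = (V r - 1) * u r := by ring
        rw [h.u_zero] at h1
        linarith [hle R hR]
      -- At R^2 = Q the two sides of `hbound` balance without the summand 1, which makes the
      -- inequality fail.
      set Q : ℝ := 1 + 4 * (d + 2) * a / ε ^ 3
      have hQ : 0 < Q := by positivity
      have h1 := hbound (√Q) (Real.sqrt_nonneg Q)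
      rw [show √Q ^ 4 = (√Q ^ 2) ^ 2 by ring, Real.sq_sqrt hQ.le] at h1
      have h2 : ε * (ε ^ 2 / (2 * d)) * (Q ^ 2 / (4 * (d + 2))) - a * (Q / (2 * d)) =
          Q / (2 * d) * (ε ^ 3 / (4 * (d + 2))) := by
        simp only [Q]
        field_simp
        ring
      have h3 : 0 < Q / (2 * d) * (ε ^ 3 / (4 * (d + 2))) := by positivity
      linarith
    rw [Metric.tendsto_atTop]
    intro ε hε
    obtain ⟨R, hR, hRε⟩ := key ε hε
    refine ⟨R, fun r hr => ?_⟩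
    rw [Real.dist_0_eq_abs, abs_of_pos (hpos r (hR.trans hr))]
    exact (hanti R r hR hr).trans_lt hRε

end IsTruncatedSolution

/-- Existence of a ground state by shooting in the initial value. -/
theorem exists_isGroundState {d : ℝ} (hd : 0 < d) : ∃ a u V, IsGroundState d a u V := by
  set K : ℝ := 1 + 32 * (d + 2) / d
  have hK1 : 1 ≤ K := le_add_of_nonneg_right (by positivity)
  have hK0 : 0 < K := by linarith
  have hKd : 32 * (d + 2) / d < K ^ 2 := by
    have : 32 * (d + 2) / d < K := lt_one_add _
    nlinarith
  obtain ⟨u, V, hsol, hdep⟩ := exists_truncated_flow hd hK0.le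
  set A : Set ℝ := {a | ∃ r, 0 < r ∧ u a r < 0}
  set B : Set ℝ := {a | ∃ s r, 0 ≤ s ∧ s < r ∧ u a s < u a r ∧ ∀ x ∈ Icc 0 r, 0 < u a x}
  have near : ∀ (a R ε : ℝ), 0 < ε → ∃ δ > 0, ∀ b ∈ Metric.ball a δ, ∀ x ∈ Icc 0 R,
      |u b x - u a x| < ε := by
    intro a R ε hε
    obtain ⟨L, hL⟩ := hdep R
    refine ⟨ε / (|L| + 1), by positivity, fun b hb x hx => ?_⟩
    rw [Metric.mem_ball, Real.dist_eq, lt_div_iff₀ (by positivity)] at hb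
    refine (hL b a x hx).trans_lt (lt_of_le_of_lt ?_ hb)
    rw [mul_comm]
    gcongr
    linarith [le_abs_self L]
  have hA : IsOpen A := by
    rw [Metric.isOpen_iff]
    rintro a ⟨r, hr, har⟩
    obtain ⟨δ, hδ, hb⟩ := near a r (-u a r) (by linarith)
    refine ⟨δ, hδ, fun b hbm => ⟨r, hr, ?_⟩⟩
    linarith [(abs_lt.1 (hb b hbm r ⟨hr.le, le_rfl⟩)).2]
  have hB : IsOpen B := by
    rw [Metric.isOpen_iff]
    rintro a ⟨s, r, hs, hsr, hlt, hpos⟩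
    obtain ⟨x, hx, hmin⟩ := isCompact_Icc.exists_isMinOn
      (nonempty_Icc.2 (hs.trans hsr.le)) ((hsol a).contDiff_u.continuous.continuousOn (s := Icc 0 r))
    -- The tolerance preserves both positivity on [0, r], through the minimum of u there, and the
    -- strict increase from s to r.
    obtain ⟨δ, hδ, hb⟩ := near a r (min (u a x) ((u a r - u a s) / 2))
      (lt_min (hpos x hx) (by linarith))
    refine ⟨δ, hδ, fun b hbm => ⟨s, r, hs, hsr, ?_, fun y hy => ?_⟩⟩
    · have h1 := (abs_lt.1 (hb b hbm s ⟨hs, hsr.le⟩)).2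
      have h2 := (abs_lt.1 (hb b hbm r ⟨hs.trans hsr.le, le_rfl⟩)).1
      have h3 := min_le_right (u a x) ((u a r - u a s) / 2)
      linarith
    · have h1 := (abs_lt.1 (hb b hbm y hy)).1
      have h2 := min_le_left (u a x) ((u a r - u a s) / 2)
      have h3 : u a x ≤ u a y := hmin hy
      linarith
  have hhalf : (1 / 2 : ℝ) ∈ Icc (1 / 2) K := ⟨le_rfl, by linarith⟩
  have hKmem : K ∈ Icc (1 / 2) K := ⟨by linarith, le_rfl⟩
  obtain ⟨a, ha, hnot⟩ : ∃ a ∈ Icc (1 / 2) K, a ∉ A ∪ B := by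
    by_contra! hcover
    obtain ⟨a, -, ⟨r, hr, hneg⟩, s, t, hs, hst, hlt, hpos⟩ :=
      isPreconnected_Icc A B hA hB hcover
        ⟨1 / 2, hhalf, (hsol _).exists_neg_of_init_lt_one hd (by norm_num) (by norm_num) hK1⟩
        ⟨K, hKmem, (hsol K).exists_increase hd hK0 hKd⟩
    exact absurd ((hsol a).pos_of_increase hd hs hst hlt hpos r hr.le) (not_lt.2 hneg.le)
  refine ⟨a, u a, V a, (hsol a).isGroundState hd (by linarith [ha.1]) ha.2 (fun r hr => ?_)
    fun s r hs hsr hpos => ?_⟩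
  · by_contra! hneg
    exact hnot (Or.inl ⟨r, hr, hneg⟩)
  · by_contra! hlt
    exact hnot (Or.inr ⟨s, r, hs, hsr, hlt, hpos⟩)

/-! ### Lane–Emden solutions and dimension at least six -/

namespace IsLaneEmdenSolution

variable {d : ℝ} {u : ℝ → ℝ}

theorem isRadial (h : IsLaneEmdenSolution d u) (hd : 0 < d) :
    IsRadial d u (deriv u) (fun r => -(u r) ^ 2) :=
  .of_contDiffOn hd h.contDiffOn h.deriv_zero h.eq

/-- A positive Lane-Emden solution tends to `0` at infinity. -/
theorem tendsto_zero (h : IsLaneEmdenSolution d u) (hd : 0 < d) (hpos : ∀ r, 0 < r → 0 < u r) :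
    Tendsto u atTop (𝓝 0) := by
  have hu := h.isRadial hd
  have hanti : ∀ s r, 0 ≤ s → s ≤ r → u r ≤ u s := fun s r hs hsr => by
    have := (hu.const_mul (-1)).monotoneOn (R := r) (fun x _ => by nlinarith [sq_nonneg (u x)])
      ⟨hs, hsr⟩ ⟨hs.trans hsr, le_rfl⟩ hsr
    linarith
  rw [Metric.tendsto_atTop]
  intro ε hε
  obtain ⟨R, hR, hRε⟩ : ∃ R, 0 < R ∧ u R < ε := by
    by_contra! hlow
    set Q : ℝ := 2 * d / ε ^ 2
    have hQ : 0 < Q := by positivity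
    have h1 := hu.le_of_laplacian_le hd (c := -ε ^ 2) (Real.sqrt_nonneg Q) fun r hr => by
      have := hlow r hr.1
      have : ε ^ 2 ≤ u r ^ 2 := by gcongr
      linarith
    have h2 : -ε ^ 2 * (Q / (2 * d)) = -1 := by
      simp only [Q]
      field_simp
    rw [Real.sq_sqrt hQ.le, h2, h.zero] at h1
    linarith [hpos (√Q) (Real.sqrt_pos.2 hQ)]
  refine ⟨R, fun r hr => ?_⟩
  rw [Real.dist_0_eq_abs, abs_of_pos (hpos r (hR.trans_le hr))]
  exact (hanti R r hR.le hr).trans_lt hRε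

/-- A positive Lane-Emden solution `u` gives the ground state `(u, 1 - u)`. -/
theorem isGroundState (h : IsLaneEmdenSolution d u) (hd : 0 < d) (hpos : ∀ r, 0 < r → 0 < u r) :
    IsGroundState d 1 u (fun r => 1 - u r) := by
  refine ⟨⟨h.contDiffOn, contDiffOn_const.sub h.contDiffOn, fun r hr => ?_, fun r hr => ?_,
    h.zero, h.deriv_zero, by simp [h.zero], ?_⟩, one_pos, hpos, fun r hr => ?_,
    h.tendsto_zero hd hpos⟩
  · rw [h.eq r hr]
    ring
  · have h1 : deriv (fun r => 1 - u r) = fun r => -deriv u r := funext fun r => deriv_const_sub 1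
    have h2 := h.eq r hr
    rw [radialLaplacian] at h2 ⊢
    rw [h1, deriv.fun_neg]
    linarith
  · rw [derivWithin_const_sub, h.deriv_zero, neg_zero]
  · have := ((h.isRadial hd).const_mul (-1)).deriv_pos hr fun s hs => by
      have := pow_pos (hpos s hs.1) 2
      linarith
    linarith

end IsLaneEmdenSolution

/-- Pohozaev's identity excludes zeros of the truncated Lane-Emden solution in dimension
`d ≥ 6`. -/
theorem IsRadial.pos_of_pohozaev {d : ℝ} {u u' : ℝ → ℝ} (hd : 6 ≤ d)
    (hu : IsRadial d u u' (fun r => -(clip 1 (u r)) ^ 2)) (h0 : u 0 = 1)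
    (hu' : Tendsto u' (𝓝[>] 0) (𝓝 0)) : ∀ r, 0 ≤ r → 0 < u r := by
  have hd0 : 0 < d := by linarith
  refine pos_of_no_first_zero hu.continuousOn (h0 ▸ one_pos) fun R hR hpos => ?_
  by_contra! hle
  have huR : u R = 0 := by
    refine le_antisymm hle (ge_of_tendsto
      ((hu.hasDerivAt R hR).continuousAt.tendsto.mono_left (nhdsWithin_le_nhds (s := Iio R))) ?_)
    filter_upwards [Ioo_mem_nhdsLT hR] with s hs
    exact (hpos s hs.1.le hs.2).le
  have hle1 : ∀ r, 0 ≤ r → u r ≤ 1 := fun r hr => by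
    have := hu.le_of_laplacian_le hd0 (c := 0) hr fun s _ => neg_nonpos.2 (sq_nonneg _)
    linarith
  have hclip : ∀ r ∈ Ioo 0 R, clip 1 (u r) = u r := fun r hr =>
    clip_eq (hpos r hr.1.le hr.2).le (hle1 r hr.1.le)
  have hneg : 0 < -1 * u' R := (hu.const_mul (-1)).deriv_pos hR fun r hr => by
    have := pow_pos (hpos r hr.1.le hr.2) 2
    simp only [hclip r hr]
    linarith
  set f : ℝ → ℝ := fun s => s ^ (d - 1) * u' s
  -- The Pohozaev functional; the coefficient d/3 cancels the u^3 terms in its derivative. Before R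
  -- the truncation is inactive and P' = r^(d-1) u'^2 (1 - d/6) ≤ 0. As P tends to 0 at the origin,
  -- P(R) ≤ 0, whereas u(R) = 0 would give P(R) = R^d u'(R)^2/2 > 0.
  set P : ℝ → ℝ := fun s =>
    s * f s * u' s / 2 + s ^ d * u s ^ 3 / 3 + d / 3 * (f s * u s)
  have hP : ∀ r ∈ Ioc 0 R, HasDerivAt P
      (r ^ (d - 1) * (u' r ^ 2 * (1 - d / 6) +
        (u r ^ 2 - clip 1 (u r) ^ 2) * (r * u' r + d / 3 * u r))) r := by
    intro r hr
    have hr0 := hr.1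
    have hf : HasDerivAt f _ r := hu.flux_hasDerivAt hr0
    have h1 := ((((hasDerivAt_id r).mul hf).mul (hu.hasDerivAt' r hr0)).div_const 2).add
      (((Real.hasDerivAt_rpow_const (p := d) (Or.inl hr0.ne')).mul
        ((hu.hasDerivAt r hr0).pow 3)).div_const 3)
    have h2 := h1.add ((hf.mul (hu.hasDerivAt r hr0)).const_mul (d / 3))
    refine h2.congr_deriv ?_
    have h3 : r ^ d = r ^ (d - 1) * r := by
      rw [Real.rpow_sub_one hr0.ne']
      field_simp
    simp only [id, Pi.mul_apply, Pi.pow_apply, f, h3]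
    field_simp
    push_cast
    ring
  have hanti : AntitoneOn P (Ioc 0 R) := by
    refine antitoneOn_of_hasDerivWithinAt_nonpos (convex_Ioc 0 R)
      (fun r hr => (hP r hr).continuousAt.continuousWithinAt)
      (fun r hr => (hP r (interior_subset hr)).hasDerivWithinAt) (fun r hr => ?_)
    rw [interior_Ioc] at hr
    rw [hclip r hr, sub_self, zero_mul, add_zero]
    refine mul_nonpos_of_nonneg_of_nonpos (Real.rpow_nonneg hr.1.le _)
      (mul_nonpos_of_nonneg_of_nonpos (sq_nonneg _) (by linarith))
  have hlim : Tendsto P (𝓝[>] 0) (𝓝 0) := by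
    have t1 : Tendsto u (𝓝[>] 0) (𝓝 1) := by
      have := (hu.continuousOn 0 self_mem_Ici).mono Ioi_subset_Ici_self
      rw [← h0]
      exact this.tendsto
    have t2 : Tendsto (fun s : ℝ => s ^ d) (𝓝[>] 0) (𝓝 0) := by
      have := (Real.continuousAt_rpow_const 0 d (Or.inr hd0.le)).tendsto.mono_left
        (nhdsWithin_le_nhds (s := Ioi 0))
      simpa [Real.zero_rpow hd0.ne'] using this
    have t3 : Tendsto (fun s : ℝ => s) (𝓝[>] 0) (𝓝 0) := nhdsWithin_le_nhds
    have t4 := ((((t3.mul hu.flux_tendsto).mul hu').div_const 2).add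
      ((t2.mul (t1.pow 3)).div_const 3)).add ((hu.flux_tendsto.mul t1).const_mul (d / 3))
    simpa using t4
  have hPR : P R ≤ 0 := by
    refine ge_of_tendsto hlim ?_
    filter_upwards [Ioc_mem_nhdsGT hR] with s hs
    exact hanti hs ⟨hR, le_rfl⟩ hs.2
  have hPR' : P R = R * R ^ (d - 1) * (-1 * u' R) ^ 2 / 2 := by
    simp only [P, f, huR]
    ring
  have : 0 < R * R ^ (d - 1) * (-1 * u' R) ^ 2 / 2 := by positivity
  linarith

/-- Truncating u to [0, 1] gives a global solution; positivity and superharmonicity yield 0 < u ≤ 1,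
so the truncation drops out. -/
theorem exists_isLaneEmdenSolution {d : ℝ} (hd : 6 ≤ d) :
    ∃ u, IsLaneEmdenSolution d u ∧ ∀ r, 0 < r → 0 < u r := by
  have hd0 : 0 < d := by linarith
  have hclip : Continuous fun x : ℝ => clip 1 x :=
    continuous_clip.comp (by fun_prop : Continuous fun x : ℝ => ((1 : ℝ), x))
  obtain ⟨Y, hY, -⟩ := exists_radial_flow hd0 (F := fun _ x : ℝ => -(clip 1 x) ^ 2) (C := 2)
    ((hclip.comp continuous_snd).pow 2).neg (fun _ => by simp [clip_eq]) (by norm_num)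
    fun t x y => by
      have h1 : |clip 1 x - clip 1 y| ≤ |x - y| := abs_clip_sub_clip_le
      have h2 : |clip 1 x + clip 1 y| ≤ 2 := by
        rw [abs_of_nonneg (add_nonneg clip_nonneg clip_nonneg)]
        linarith [clip_le (x := x) zero_le_one, clip_le (x := y) zero_le_one]
      rw [neg_sub_neg, norm_sub_rev, sq_sub_sq, norm_mul]
      refine (mul_le_mul h2 h1 (abs_nonneg _) (by norm_num)).trans ?_
      rw [Real.norm_eq_abs]
      nlinarith [mul_nonneg (sq_nonneg t) (abs_nonneg (x - y))]
  obtain ⟨hC, h0, h1, hE⟩ := hY 1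
  set u := Y 1
  have hu := IsRadial.of_contDiff hd0 hC h1 hE
  have hdc : Continuous (deriv u) := hC.continuous_deriv (by norm_num)
  have hpos := hu.pos_of_pohozaev hd h0 (by
    have := (hdc.tendsto 0).mono_left (nhdsWithin_le_nhds (s := Ioi 0))
    rwa [h1] at this)
  refine ⟨u, ⟨hC.contDiffOn, fun r hr => ?_, h0, ?_⟩, fun r hr => hpos r hr.le⟩
  · have hle := hu.le_of_laplacian_le hd0 (c := 0) hr.le fun s _ => neg_nonpos.2 (sq_nonneg _)
    rw [← clip_eq (K := 1) (hpos r hr.le).le (by linarith)]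
    exact hE r hr
  · rw [(hC.differentiable (by norm_num) 0).derivWithin (uniqueDiffOn_Ici 0 0 self_mem_Ici), h1]

theorem isLaneEmdenSolution_six : IsLaneEmdenSolution 6 fun r => ((1 + r ^ 2 / 24) ^ 2)⁻¹ := by
  have hb : ∀ r : ℝ, 0 < 1 + r ^ 2 / 24 := fun r => by positivity
  have hbase : ∀ r : ℝ, HasDerivAt (fun r : ℝ => 1 + r ^ 2 / 24) (r / 12) r := fun r =>
    (((hasDerivAt_pow 2 r).div_const 24).const_add 1).congr_deriv (by norm_num; ring)
  have h1 : ∀ r : ℝ, HasDerivAt (fun r : ℝ => ((1 + r ^ 2 / 24) ^ 2)⁻¹)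
      (-(r / 6) * ((1 + r ^ 2 / 24) ^ 3)⁻¹) r := fun r => by
    refine (((hbase r).pow 2).inv (pow_ne_zero 2 (hb r).ne')).congr_deriv ?_
    have := (hb r).ne'
    simp only [Pi.pow_apply]
    field_simp
    norm_num
    ring
  have h2 : ∀ r : ℝ, HasDerivAt (fun r : ℝ => -(r / 6) * ((1 + r ^ 2 / 24) ^ 3)⁻¹)
      (-(1 / 6) * ((1 + r ^ 2 / 24) ^ 3)⁻¹ + r ^ 2 / 24 * ((1 + r ^ 2 / 24) ^ 4)⁻¹) r := fun r => by
    refine ((((hasDerivAt_id r).div_const 6).neg).mul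
      (((hbase r).pow 3).inv (pow_ne_zero 3 (hb r).ne'))).congr_deriv ?_
    have := (hb r).ne'
    simp only [Pi.pow_apply, Pi.inv_apply, Pi.neg_apply, id]
    field_simp
    norm_num
    ring
  have hC : ContDiff ℝ 2 fun r : ℝ => ((1 + r ^ 2 / 24) ^ 2)⁻¹ :=
    ContDiff.inv (by fun_prop) fun r => pow_ne_zero 2 (hb r).ne'
  refine ⟨hC.contDiffOn, fun r hr => ?_, by norm_num, ?_⟩
  · rw [radialLaplacian, funext fun r => (h1 r).deriv, (h2 r).deriv]
    have := (hb r).ne'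
    field_simp
    ring
  · rw [(h1 0).hasDerivWithinAt.derivWithin (uniqueDiffOn_Ici 0 0 self_mem_Ici)]
    norm_num

theorem mainTheorem1 (d : ℝ) (hd : 0 < d) :
    ∃ (u₀ : ℝ) (u V : ℝ → ℝ),
      IsGroundState d u₀ u V ∧
      (∀ (w₀ : ℝ) (w W : ℝ → ℝ), IsGroundState d w₀ w W →
        w₀ = u₀ ∧ Set.EqOn w u (Set.Ici 0) ∧ Set.EqOn W V (Set.Ici 0)) ∧
      (d = 6 → ∀ r : ℝ, 0 ≤ r → u r = ((1 + r ^ 2 / 24) ^ 2)⁻¹) ∧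
      (6 ≤ d → (∀ r : ℝ, 0 ≤ r → u r = 1 - V r) ∧ IsLaneEmdenSolution d u) := by
  -- For d ≥ 6 the Lane–Emden solution is itself the ground state, so shooting is needed only below
  -- 6.
  by_cases h6 : 6 ≤ d
  · obtain ⟨u, hu, hpos⟩ := exists_isLaneEmdenSolution h6
    have hG := hu.isGroundState hd hpos
    refine ⟨1, u, fun r => 1 - u r, hG, fun _ _ _ k => hG.unique k hd, ?_,
      fun _ => ⟨fun r _ => by ring, hu⟩⟩
    rintro rfl r hr
    have k := isLaneEmdenSolution_six.isGroundState hd fun r _ => by positivity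
    exact ((hG.unique k hd).2.1 hr).symm
  · obtain ⟨a, u, V, hG⟩ := exists_isGroundState hd
    exact ⟨a, u, V, hG, fun _ _ _ k => hG.unique k hd, fun h => absurd h.ge h6,
      fun h => absurd h h6⟩
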